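/- **Definitions.** Let $(X,\mathfrak M,\mu)$ be a measure space. A family $\mathscr B\subset\mathfrak M$ (whose members are called balls) is a *ball-basis* with constant $\mathcal K>0$ if * (B1) $0<\mu(B)<\infty$ for every $B\in\mathscr B$; * (B2) any two points of $X$ lie in a common ball; * (B3) for every $E\in\mathfrak M$ and $\varepsilon>0$ there is a finite or infinite sequence of balls $B_k$ with $\mu(E\bigtriangleup\bigcup_kB_k)<\varepsilon$; * (B4) every $B\in\mathscr B$ has a ball $B^*\in\mathscr B$ (its hull, fixed once and for all) with $\mu(B^*)\le\mathcal K\mu(B)$ that contains every ball $A$ with $\mu(A)\le2\mu(B)$ and $A\cap B\ne\varnothing$. Put $\langle f\rangle_B=\frac1{\mu(B)}\int_B|f|\,d\mu$ and $\langle f\rangle_B^*=\sup_{A\in\mathscr B,\,A\supset B}\langle f\rangle_A$. An operator $T$ from $L^1(\mu)$ to (possibly non-measurable, extended real valued) functions on $X$ is *subadditive* if $|T(\lambda f)(x)|=|\lambda||Tf(x)|$ and $|T(f+g)(x)|\le|Tf(x)|+|Tg(x)|$ for all $f,g\in L^1(\mu)$, $\lambda\in\mathbb R$, $x\in X$. A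 subadditive $T$ is a *bounded oscillation (BO) operator* with respect to $\mathscr B$ if there are finite constants $\mathcal L_1,\mathcal L_2$ such that * (T1) $|T(f\mathbf 1_{X\setminus B^*})(x)-T(f\mathbf 1_{X\setminus B^*})(x')|\le\mathcal L_1\langle f\rangle_B^*$ for all $B\in\mathscr B$, $x,x'\in B$, $f\in L^1(\mu)$; * (T2) for every $A\in\mathscr B$ with $A^*\ne X$ there is a ball $B\supsetneq A$ such that $|T(f\mathbf 1_{B^*\setminus A^*})(x)|\le\mathcal L_2\langle f\rangle_{B^*}$ for all $x\in A$, $f\in L^1(\mu)$. The maximal function of $\mathscr B$ is $Mf(x)=\sup_{B\in\mathscr B,\,x\in B}\langle f\rangle_B$. For $1<p<\infty$, an *$A_p$ weight* is a measurable, a.e. positive function $w:X\to\mathbb R$ with $$[w]_{A_p}=\sup_{B\in\mathscr B}\Big(\frac1{\mu(B)}\int_Bw\,d\mu\Big)\Big(\frac1{\mu(B)}\int_Bw^{-1/(p-1)}\,d\mu\Big)^{p-1}<\infty .$$ $L^p(w)$ is $L^p$ of the measure $w\,d\mu$; with $w^*$ the outer measure of $w\,d\mu$, the norm of a possibly non-measurable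 function $g$ is $\|g\|_{L^p(w)}=\big(p\int_0^\infty t^{p-1}w^*\{|g|>t\}\,dt\big)^{1/p}$, and $\|M\|_{L^p(w)\to L^p(w)}=\sup_{f\in L^p(w)}\|Mf\|_{L^p(w)}/\|f\|_{L^p(w)}$. The family $\mathscr B$ satisfies the *Besicovitch $D$-condition*, $D\in\mathbb N$, if every $\mathscr A\subset\mathscr B$ has a subfamily $\mathscr A'\subset\mathscr A$ with $\bigcup_{A\in\mathscr A'}A=\bigcup_{A\in\mathscr A}A$ and $\sum_{A\in\mathscr A'}\mathbf 1_A\le D$ everywhere on $X$. **Theorem.** Let $\mathscr B$ be a ball-basis, with constant $\mathcal K$, of a measure space $(X,\mathfrak M,\mu)$. 1. The maximal operator $M$ is a BO operator with respect to $\mathscr B$. 2. Let $1<p<\infty$. There is a constant $C$, depending only on $p$ and $\mathcal K$, such that for every $A_p$ weight $w$ $$\|M\|_{L^p(w)\to L^p(w)}\le C\,[w]_{A_p}^{\max\left\{\frac{p+2}{p(p-1)},\,\frac{3p-2}{p}\right\}} .$$ 3. Let $1<p<\infty$ and suppose in addition that $\mathscr B$ satisfies the Besicovitch $D$-condition. There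 is a constant $C$, depending only on $p$, $\mathcal K$ and $D$, such that for every $A_p$ weight $w$ $$\|M\|_{L^p(w)\to L^p(w)}\le C\,[w]_{A_p}^{\max\left\{1,\,\frac1{p-1}\right\}} .$$ -/

import Mathlib

open MeasureTheory Set
open scoped ENNReal NNReal symmDiff

universe u

namespace BallBasis

noncomputable section

variable {X : Type u} [MeasurableSpace X]

/-- `𝓑` is a ball-basis of the measure space `(X, μ)`, with the hull of a ball `B` being
`hull B` and with hull constant `K`. (The hull is any fixed choice of a ball as in (B4); only
its values on members of `𝓑` matter.) -/
structure IsBallBasis (μ : Measure X) (𝓑 : Set (Set X)) (hull : Set X → Set X) (K : ℝ) :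
    Prop where
  /-- Balls are measurable sets. -/
  measurableSet : ∀ B ∈ 𝓑, MeasurableSet B
  /-- (B1) -/
  measure_pos : ∀ B ∈ 𝓑, 0 < μ B
  /-- (B1) -/
  measure_lt_top : ∀ B ∈ 𝓑, μ B < ∞
  /-- (B2) -/
  exists_ball : ∀ x y : X, ∃ B ∈ 𝓑, x ∈ B ∧ y ∈ B
  /-- (B3) A finite or infinite sequence of balls is a countable subfamily. -/
  approx : ∀ E : Set X, MeasurableSet E → ∀ ε : ℝ, 0 < ε →
    ∃ 𝒞 ⊆ 𝓑, 𝒞.Countable ∧ μ (E ∆ ⋃₀ 𝒞) < ENNReal.ofReal ε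
  /-- (B4) -/
  const_pos : 0 < K
  /-- (B4) -/
  hull_mem : ∀ B ∈ 𝓑, hull B ∈ 𝓑
  /-- (B4) -/
  subset_hull : ∀ B ∈ 𝓑, (⋃₀ {A ∈ 𝓑 | μ A ≤ 2 * μ B ∧ (A ∩ B).Nonempty}) ⊆ hull B
  /-- (B4) -/
  measure_hull_le : ∀ B ∈ 𝓑, μ (hull B) ≤ ENNReal.ofReal K * μ B

/-- The mean `⟨f⟩_{B,r} = (μ(B)⁻¹ ∫_B |f|^r dμ)^{1/r}`. -/
def avg (μ : Measure X) (r : ℝ) (f : X → ℝ) (B : Set X) : ℝ≥0∞ :=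
  ((μ B)⁻¹ * ∫⁻ x in B, ‖f x‖ₑ ^ r ∂μ) ^ (1 / r)

/-- `⟨f⟩*_{B,r}`, the supremum of `⟨f⟩_{A,r}` over the balls `A ⊇ B`. -/
def avgStar (μ : Measure X) (𝓑 : Set (Set X)) (r : ℝ) (f : X → ℝ) (B : Set X) : ℝ≥0∞ :=
  ⨆ A ∈ 𝓑, ⨆ _ : B ⊆ A, avg μ r f A

/-- The maximal operator `M_r f(x) = sup_{x ∈ B ∈ 𝓑} ⟨f⟩_{B,r}`. -/
def maximalOperator (μ : Measure X) (𝓑 : Set (Set X)) (r : ℝ) (f : X → ℝ) (x : X) : EReal :=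
  ((⨆ B ∈ 𝓑, ⨆ _ : x ∈ B, avg μ r f B : ℝ≥0∞) : EReal)

/-- `T` is a subadditive operator from `L^r(μ)` to arbitrary (possibly non-measurable) functions
on `X`. An element of `L^r(μ)` is represented by a function, and `T` does not depend on the
representative. Values in `EReal` are allowed because maximal functions can be infinite on a null
set; `EReal.abs` is the absolute value, in `[0, ∞]`. -/
structure IsSubadditive (μ : Measure X) (r : ℝ) (T : (X → ℝ) → X → EReal) : Prop where
  congr : ∀ f g : X → ℝ, MemLp f (ENNReal.ofReal r) μ → MemLp g (ENNReal.ofReal r) μ →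
    f =ᵐ[μ] g → T f = T g
  smul : ∀ (c : ℝ) (f : X → ℝ), MemLp f (ENNReal.ofReal r) μ →
    ∀ x, (T (c • f) x).abs = ENNReal.ofReal |c| * (T f x).abs
  add : ∀ f g : X → ℝ, MemLp f (ENNReal.ofReal r) μ → MemLp g (ENNReal.ofReal r) μ →
    ∀ x, (T (f + g) x).abs ≤ (T f x).abs + (T g x).abs

/-- `T` is a bounded oscillation operator, on `L^r(μ)`, with respect to the ball-basis `𝓑`.
In the difference below, `∞ - ∞` has absolute value `∞` in `EReal`, so that the bound in (T1)
makes the two values finite whenever `⟨f⟩*_{B,r}` is finite. -/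
structure IsBO (μ : Measure X) (𝓑 : Set (Set X)) (hull : Set X → Set X) (r : ℝ)
    (T : (X → ℝ) → X → EReal) : Prop where
  subadditive : IsSubadditive μ r T
  /-- (T1) -/
  localization : ∃ L₁ : ℝ≥0, ∀ B ∈ 𝓑, ∀ x ∈ B, ∀ x' ∈ B, ∀ f : X → ℝ,
    MemLp f (ENNReal.ofReal r) μ →
      (T ((hull B)ᶜ.indicator f) x - T ((hull B)ᶜ.indicator f) x').abs ≤
        L₁ * avgStar μ 𝓑 r f B
  /-- (T2) -/
  connectivity : ∃ L₂ : ℝ≥0, ∀ A ∈ 𝓑, hull A ≠ univ → ∃ B ∈ 𝓑, A ⊂ B ∧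
    ∀ x ∈ A, ∀ f : X → ℝ, MemLp f (ENNReal.ofReal r) μ →
      (T ((hull B \ hull A).indicator f) x).abs ≤ L₂ * avg μ r f (hull B)

/-- A weight: a measurable function that is positive (and finite) almost everywhere. -/
structure IsWeight (μ : Measure X) (w : X → ℝ) : Prop where
  aemeasurable : AEMeasurable w μ
  pos : ∀ᵐ x ∂μ, 0 < w x

/-- The measure `w dμ`. -/
def weightMeasure (μ : Measure X) (w : X → ℝ) : Measure X :=
  μ.withDensity fun x => ENNReal.ofReal (w x)

/-- The characteristic
`[w]_{A_p} = sup_B (μ(B)⁻¹ ∫_B w dμ) (μ(B)⁻¹ ∫_B w^{-1/(p-1)} dμ)^{p-1}`. -/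
def apConst (μ : Measure X) (𝓑 : Set (Set X)) (p : ℝ) (w : X → ℝ) : ℝ≥0∞ :=
  ⨆ B ∈ 𝓑, ((μ B)⁻¹ * ∫⁻ x in B, ENNReal.ofReal (w x) ∂μ) *
    ((μ B)⁻¹ * ∫⁻ x in B, ENNReal.ofReal (w x) ^ (-1 / (p - 1)) ∂μ) ^ (p - 1)

/-- `w` is an `A_p` weight with respect to `𝓑`. -/
def IsApWeight (μ : Measure X) (𝓑 : Set (Set X)) (p : ℝ) (w : X → ℝ) : Prop :=
  IsWeight μ w ∧ apConst μ 𝓑 p w < ∞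

/-- The `L^p(ν)` norm of a possibly non-measurable function,
`(p ∫_0^∞ t^{p-1} ν*{|g| > t} dt)^{1/p}`, where `ν*` is the outer measure. (A Mathlib measure,
evaluated at an arbitrary set, is its outer measure.) -/
def outerLpNorm (ν : Measure X) (p : ℝ) (g : X → EReal) : ℝ≥0∞ :=
  (ENNReal.ofReal p * ∫⁻ t in Ioi (0 : ℝ),
    ENNReal.ofReal (t ^ (p - 1)) * ν {x | ENNReal.ofReal t < (g x).abs}) ^ (1 / p)

/-- The norm `‖T‖_{L^p(ν) → L^p(ν)} = sup_{f ∈ L^p(ν)} ‖Tf‖_{L^p(ν)} / ‖f‖_{L^p(ν)}`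
(here `0 / 0 = 0` and `a / 0 = ∞` for `a ≠ 0`). -/
def opNorm (ν : Measure X) (p : ℝ) (T : (X → ℝ) → X → EReal) : ℝ≥0∞ :=
  ⨆ f : X → ℝ, ⨆ _ : MemLp f (ENNReal.ofReal p) ν,
    outerLpNorm ν p (T f) / eLpNorm f (ENNReal.ofReal p) ν

/-- The Besicovitch `D`-condition. -/
def IsBesicovitch (𝓑 : Set (Set X)) (D : ℕ) : Prop :=
  ∀ 𝒜 ⊆ 𝓑, ∃ 𝒜' ⊆ 𝒜, ⋃₀ 𝒜' = ⋃₀ 𝒜 ∧ ∀ x, {A ∈ 𝒜' | x ∈ A}.encard ≤ D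

end

end BallBasis

namespace BallBasis

variable {X : Type u} [MeasurableSpace X]

/-! The BO property rests on a dichotomy. A ball `A` meeting `B` either has measure at most `2 * μ
B`, hence lies in `hull B` and does not see a function supported off that hull, or is larger, hence
has `B` inside `hull A`, and its mean is at most `K` times the mean over `hull A`. For (T2) the new
ball is the hull of an almost smallest large ball meeting `A`.

The weighted bounds follow Lerner's pointwise argument. With `W` the weight, `S = W ^ (-1/(p-1))`
its dual and `Q` the characteristic, `IsApPair.lerner_pointwise` dominates `M F` by `(Q * M_W ((M_S
(F/S))^(p-1) / W)) ^ (1/(p-1))`, where `M_W` and `M_S` average against `W dμ` and `S dμ`. It remains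
to bound `M_S` on `L^p(S)` and `M_W` on `L^{p'}(W)`, with `p' = p/(p-1)`;
`HasWeakType.exists_majorant` gets both from weak type `(1,1)`.

The Besicovitch condition makes both weak constants equal to `D`, and only the power `1/(p-1)` of
`Q` survives. For a general basis, Vitali selection gives as weak constants the doubling constants
of `W` and `S`, of order `Q` and `Q ^ (1/(p-1))`. After the `p`-th root the total power is
`2/(p-1)`, which is at most the stated exponent.

Maximal functions may be non-measurable, so each is replaced by a measurable majorant with the same
distribution function before it is integrated or averaged again. -/

theorem abs_coe_ennreal (a : ℝ≥0∞) : (a : EReal).abs = a := by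
  induction a with
  | top => simp
  | coe a =>
    rw [show ((a : ℝ≥0∞) : EReal) = ((a : ℝ) : EReal) from rfl, EReal.abs_def]
    simp

/-- Used for (T1), where no cancellation is needed: each of the two values is bounded on its own. A
finite bound forces both to be finite, and `∞ - ∞` can occur only when the bound is `∞`. -/
theorem abs_coe_sub_coe_le {a b c : ℝ≥0∞} (ha : a ≤ c) (hb : b ≤ c) :
    ((a : EReal) - (b : EReal)).abs ≤ c := by
  induction c with
  | top => exact le_top
  | coe c =>
    lift a to ℝ≥0 using (ha.trans_lt ENNReal.coe_lt_top).ne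
    lift b to ℝ≥0 using (hb.trans_lt ENNReal.coe_lt_top).ne
    have ha' : (a : ℝ) ≤ c := by exact_mod_cast ha
    have hb' : (b : ℝ) ≤ c := by exact_mod_cast hb
    rw [show ((a : ℝ≥0∞) : EReal) = ((a : ℝ) : EReal) from rfl,
      show ((b : ℝ≥0∞) : EReal) = ((b : ℝ) : EReal) from rfl, ← EReal.coe_sub, EReal.abs_def,
      ← ENNReal.ofReal_coe_nnreal]
    apply ENNReal.ofReal_le_ofReal
    rw [abs_le]
    constructor <;> linarith [a.2, b.2, show (0 : ℝ) ≤ a from a.2, show (0 : ℝ) ≤ b from b.2]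

theorem inv_le_mul_inv_of_le_mul {a b c : ℝ≥0∞} (h : b ≤ c * a) (hb : b ≠ 0) (hb' : b ≠ ∞) : a⁻¹ ≤ c * b⁻¹ := by
  rw [← div_eq_mul_inv, ENNReal.le_div_iff_mul_le (Or.inl hb) (Or.inl hb'), mul_comm,
    ← div_eq_mul_inv]
  exact ENNReal.div_le_of_le_mul h

/-- The maximal function of a nonnegative function, with respect to an arbitrary measure. -/
noncomputable def maximalFn (μ : Measure X) (𝓑 : Set (Set X)) (g : X → ℝ≥0∞) (x : X) : ℝ≥0∞ :=
  ⨆ B ∈ 𝓑, ⨆ _ : x ∈ B, (μ B)⁻¹ * ∫⁻ y in B, g y ∂μ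

theorem le_maximalFn {μ : Measure X} {𝓑 : Set (Set X)} (g : X → ℝ≥0∞) {x : X} {B : Set X}
    (hB : B ∈ 𝓑) (hx : x ∈ B) : (μ B)⁻¹ * ∫⁻ y in B, g y ∂μ ≤ maximalFn μ 𝓑 g x :=
  le_iSup₂_of_le B hB (le_iSup_of_le hx le_rfl)

theorem maximalFn_le {μ : Measure X} {𝓑 : Set (Set X)} {g : X → ℝ≥0∞} {x : X} {c : ℝ≥0∞}
    (h : ∀ B ∈ 𝓑, x ∈ B → (μ B)⁻¹ * ∫⁻ y in B, g y ∂μ ≤ c) : maximalFn μ 𝓑 g x ≤ c :=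
  iSup₂_le fun B hB => iSup_le fun hx => h B hB hx

theorem avg_one (μ : Measure X) (f : X → ℝ) (B : Set X) :
    avg μ 1 f B = (μ B)⁻¹ * ∫⁻ y in B, ‖f y‖ₑ ∂μ := by
  simp [avg]

theorem maximalOperator_one (μ : Measure X) (𝓑 : Set (Set X)) (f : X → ℝ) (x : X) :
    maximalOperator μ 𝓑 1 f x = (maximalFn μ 𝓑 (fun y => ‖f y‖ₑ) x : EReal) := by
  simp only [maximalOperator, avg_one, maximalFn]

theorem maximalFn_congr {μ : Measure X} {𝓑 : Set (Set X)} {f g : X → ℝ≥0∞} (h : f =ᵐ[μ] g) :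
    maximalFn μ 𝓑 f = maximalFn μ 𝓑 g := by
  funext x
  simp only [maximalFn]
  refine iSup_congr fun B => iSup_congr fun _ => iSup_congr fun _ => ?_
  congr 1
  exact lintegral_congr_ae (ae_restrict_of_ae h)

/-! ### The maximal operator has bounded oscillation -/

theorem isSubadditive_maximalOperator (μ : Measure X) (𝓑 : Set (Set X)) :
    IsSubadditive μ 1 (maximalOperator μ 𝓑 1) where
  congr f g _ _ hfg := by
    funext x
    rw [maximalOperator_one, maximalOperator_one, maximalFn_congr]
    filter_upwards [hfg] with y hy
    rw [hy]
  smul c f hf x := by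
    simp only [maximalOperator_one, abs_coe_ennreal, maximalFn, ENNReal.mul_iSup]
    refine iSup_congr fun B => iSup_congr fun _ => iSup_congr fun _ => ?_
    rw [mul_left_comm, ← lintegral_const_mul' _ _ ENNReal.ofReal_ne_top]
    simp [enorm_mul, Real.enorm_eq_ofReal_abs]
  add f g hf hg x := by
    simp only [maximalOperator_one, abs_coe_ennreal]
    refine maximalFn_le fun B hB hx => ?_
    refine le_trans ?_ (add_le_add (le_maximalFn _ hB hx) (le_maximalFn _ hB hx))
    rw [← mul_add, ← lintegral_add_left' hf.aestronglyMeasurable.enorm.restrict]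
    gcongr
    exact enorm_add_le _ _

namespace IsBallBasis

variable {μ : Measure X} {𝓑 : Set (Set X)} {hull : Set X → Set X} {K : ℝ}

theorem subset_hull_of_le (h : IsBallBasis μ 𝓑 hull K) {A B : Set X} (hA : A ∈ 𝓑) (hB : B ∈ 𝓑)
    (hle : μ A ≤ 2 * μ B) (hAB : (A ∩ B).Nonempty) : A ⊆ hull B :=
  (subset_sUnion_of_mem (show A ∈ {A ∈ 𝓑 | μ A ≤ 2 * μ B ∧ (A ∩ B).Nonempty} from
    ⟨hA, hle, hAB⟩)).trans (h.subset_hull B hB)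

theorem subset_hull_self (h : IsBallBasis μ 𝓑 hull K) {B : Set X} (hB : B ∈ 𝓑) :
    B ⊆ hull B := by
  refine h.subset_hull_of_le hB hB ?_ ?_
  · rw [two_mul]; exact le_self_add
  · rw [inter_self]; exact nonempty_of_measure_ne_zero (h.measure_pos B hB).ne'

theorem measure_ne_zero (h : IsBallBasis μ 𝓑 hull K) {B : Set X} (hB : B ∈ 𝓑) : μ B ≠ 0 :=
  (h.measure_pos B hB).ne'

theorem measure_ne_top (h : IsBallBasis μ 𝓑 hull K) {B : Set X} (hB : B ∈ 𝓑) : μ B ≠ ∞ :=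
  (h.measure_lt_top B hB).ne

theorem nonempty (h : IsBallBasis μ 𝓑 hull K) {B : Set X} (hB : B ∈ 𝓑) : B.Nonempty :=
  nonempty_of_measure_ne_zero (h.measure_ne_zero hB)

/-- A ball that meets `B` and is not much larger than `B` lies in the hull of `B`, so a function
supported off the hull has integral zero over it. -/
theorem setLIntegral_indicator_eq_zero (h : IsBallBasis μ 𝓑 hull K) {A B S : Set X}
    (hA : A ∈ 𝓑) (hB : B ∈ 𝓑) (hle : μ A ≤ 2 * μ B) (hAB : (A ∩ B).Nonempty)
    (hS : Disjoint S (hull B)) (f : X → ℝ) : ∫⁻ y in A, ‖S.indicator f y‖ₑ ∂μ = 0 := by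
  have hsub := h.subset_hull_of_le hA hB hle hAB
  rw [setLIntegral_congr_fun (g := fun _ => 0) (h.measurableSet A hA), lintegral_zero]
  intro y hy
  have : y ∉ S := fun hyS => hS.le_bot ⟨hyS, hsub hy⟩
  simp [this]

/-- Small balls through `x` contribute nothing. A ball `A` with `μ A > 2 * μ B` satisfies `B ⊆ hull
A`, so `hull A` competes in `avgStar`, and passing from `A` to its hull costs a factor `K`. -/
theorem maximalFn_indicator_compl_hull_le (h : IsBallBasis μ 𝓑 hull K) {B : Set X} (hB : B ∈ 𝓑)
    {x : X} (hx : x ∈ B) (f : X → ℝ) :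
    maximalFn μ 𝓑 (fun y => ‖(hull B)ᶜ.indicator f y‖ₑ) x ≤
      ENNReal.ofReal K * avgStar μ 𝓑 1 f B := by
  refine maximalFn_le fun A hA hxA => ?_
  rcases le_or_gt (μ A) (2 * μ B) with hle | hlt
  · rw [h.setLIntegral_indicator_eq_zero hA hB hle ⟨x, hxA, hx⟩ disjoint_compl_left]
    simp
  have hBA : B ⊆ hull A := h.subset_hull_of_le hB hA
    (by
      have h1 : μ B ≤ 2 * μ B := by rw [two_mul]; exact le_self_add
      have h2 : μ A ≤ 2 * μ A := by rw [two_mul]; exact le_self_add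
      exact h1.trans (hlt.le.trans h2)) ⟨x, hx, hxA⟩
  have h1 : avg μ 1 f (hull A) ≤ avgStar μ 𝓑 1 f B :=
    le_iSup₂_of_le (hull A) (h.hull_mem A hA) (le_iSup_of_le hBA le_rfl)
  refine le_trans ?_ (mul_le_mul_right h1 _)
  rw [avg_one, ← mul_assoc]
  gcongr ?_ * ?_
  · have hm := h.measure_hull_le A hA
    have hH := h.hull_mem A hA
    exact inv_le_mul_inv_of_le_mul hm
      (h.measure_ne_zero hH) (h.measure_ne_top hH)
  · refine (lintegral_mono_set (h.subset_hull_self hA)).trans (lintegral_mono fun y => ?_)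
    by_cases hy : y ∈ hull B <;> simp [hy]

/-- Among the balls meeting `A` with measure above `2 * μ A`, take `G` within a factor 2 of the
least measure and use `hull G`. A ball that contributes at a point of `A` belongs to this family, so
its measure is comparable to that of `hull (hull G)`: two hulls give `K ^ 2`, near-minimality gives
2. -/
theorem exists_ball_connectivity (h : IsBallBasis μ 𝓑 hull K) {A : Set X} (hA : A ∈ 𝓑)
    (hne : hull A ≠ univ) : ∃ B ∈ 𝓑, A ⊂ B ∧ ∀ x ∈ A, ∀ f : X → ℝ,
      maximalFn μ 𝓑 (fun y => ‖(hull B \ hull A).indicator f y‖ₑ) x ≤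
        2 * ENNReal.ofReal K ^ 2 * avg μ 1 f (hull B) := by
  set 𝒢 : Set (Set X) := {G ∈ 𝓑 | (G ∩ A).Nonempty ∧ 2 * μ A < μ G} with h𝒢
  set s : ℝ≥0∞ := ⨅ G ∈ 𝒢, μ G with hs
  have hA0 := h.measure_ne_zero hA
  -- The family is nonempty: a ball joining `A` to a point outside `hull A` cannot be small.
  obtain ⟨y, hy⟩ := (ne_univ_iff_exists_notMem _).1 hne
  obtain ⟨a, ha⟩ := h.nonempty hA
  obtain ⟨G₀, hG₀, haG, hyG⟩ := h.exists_ball a y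
  have hG₀' : G₀ ∈ 𝒢 := by
    refine ⟨hG₀, ⟨a, haG, ha⟩, ?_⟩
    by_contra hcon
    exact hy (h.subset_hull_of_le hG₀ hA (not_lt.1 hcon) ⟨a, haG, ha⟩ hyG)
  have hs0 : s ≠ 0 := by
    have : 2 * μ A ≤ s := le_iInf₂ fun G hG => hG.2.2.le
    intro h0
    rw [h0] at this
    simp [hA0] at this
  have hsT : s ≠ ∞ := ((iInf₂_le G₀ hG₀').trans_lt (h.measure_lt_top _ hG₀)).ne
  have hlt : s < 2 * s := by
    rw [two_mul]; exact ENNReal.lt_add_right hsT hs0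
  -- The infimum need not be attained; it is positive and finite, so some member lies below its
  -- double.
  obtain ⟨G, hG, hGs⟩ : ∃ G ∈ 𝒢, μ G < 2 * s := by
    simpa [hs, iInf_lt_iff] using hlt
  have hGB := hG.1
  have hAG : μ A < μ G := lt_of_le_of_lt (by rw [two_mul]; exact le_self_add) hG.2.2
  have hAsub : A ⊆ hull G := h.subset_hull_of_le hA hGB
    (hAG.le.trans (by rw [two_mul]; exact le_self_add)) (by rw [inter_comm]; exact hG.2.1)
  have hBm := h.hull_mem G hGB
  refine ⟨hull G, hBm, ⟨hAsub, fun hsub => ?_⟩, fun x hx f => maximalFn_le fun Q hQ hxQ => ?_⟩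
  · exact absurd (measure_mono ((h.subset_hull_self hGB).trans hsub)) (not_le.2 hAG)
  rcases le_or_gt (μ Q) (2 * μ A) with hle | hlt
  · rw [h.setLIntegral_indicator_eq_zero hQ hA hle ⟨x, hxQ, hx⟩ disjoint_sdiff_left]
    simp
  have hsQ : s ≤ μ Q := iInf₂_le Q ⟨hQ, ⟨x, hxQ, hx⟩, hlt⟩
  have hHH := h.hull_mem _ hBm
  have hμ : μ (hull (hull G)) ≤ 2 * ENNReal.ofReal K ^ 2 * μ Q := by
    calc μ (hull (hull G)) ≤ ENNReal.ofReal K * μ (hull G) := h.measure_hull_le _ hBm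
      _ ≤ ENNReal.ofReal K * (ENNReal.ofReal K * (2 * μ Q)) := by
          gcongr
          refine (h.measure_hull_le _ hGB).trans ?_
          gcongr
          exact hGs.le.trans (by gcongr)
      _ = _ := by ring
  rw [avg_one, ← mul_assoc]
  gcongr ?_ * ?_
  · exact inv_le_mul_inv_of_le_mul hμ
      (h.measure_ne_zero hHH) (h.measure_ne_top hHH)
  · rw [← lintegral_indicator (h.measurableSet Q hQ), ← lintegral_indicator (h.measurableSet _ hHH)]
    refine lintegral_mono fun y => ?_
    by_cases hyQ : y ∈ Q
    · by_cases hy : y ∈ hull (hull G) <;> by_cases hy' : y ∈ hull A <;> simp [hy, hy', hyQ]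
    · simp [hyQ]

end IsBallBasis

theorem isBO_maximalOperator {μ : Measure X} {𝓑 : Set (Set X)} {hull : Set X → Set X} {K : ℝ}
    (h : IsBallBasis μ 𝓑 hull K) : IsBO μ 𝓑 hull 1 (maximalOperator μ 𝓑 1) where
  subadditive := isSubadditive_maximalOperator μ 𝓑
  localization := by
    refine ⟨K.toNNReal, fun B hB x hx x' hx' f _ => ?_⟩
    rw [maximalOperator_one, maximalOperator_one]
    exact abs_coe_sub_coe_le (h.maximalFn_indicator_compl_hull_le hB hx f)
      (h.maximalFn_indicator_compl_hull_le hB hx' f)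
  connectivity := by
    refine ⟨2 * K.toNNReal ^ 2, fun A hA hne => ?_⟩
    obtain ⟨B, hB, hAB, hM⟩ := h.exists_ball_connectivity hA hne
    refine ⟨B, hB, hAB, fun x hx f _ => ?_⟩
    rw [maximalOperator_one, abs_coe_ennreal]
    exact_mod_cast hM x hx f

/-! ### Layer cake formulas and measurable majorants -/

theorem setLIntegral_rpow_Ioo {r : ℝ} (hr : -1 < r) {a : ℝ} (ha : 0 ≤ a) :
    ∫⁻ t in Ioo 0 a, ENNReal.ofReal (t ^ r) =
      (ENNReal.ofReal (r + 1))⁻¹ * ENNReal.ofReal a ^ (r + 1) := by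
  have hr1 : 0 < r + 1 := by linarith
  have hint : IntegrableOn (fun t : ℝ => t ^ r) (Ioo 0 a) :=
    ((intervalIntegral.intervalIntegrable_rpow' hr).1 : IntegrableOn _ (Ioc 0 a) _).mono_set
      Ioo_subset_Ioc_self
  rw [← ofReal_integral_eq_lintegral_ofReal hint, ← integral_Ioc_eq_integral_Ioo,
    ← intervalIntegral.integral_of_le ha, integral_rpow (Or.inl hr), Real.zero_rpow hr1.ne',
    sub_zero, div_eq_inv_mul, ENNReal.ofReal_mul (by positivity), ENNReal.ofReal_inv_of_pos hr1,
    ENNReal.ofReal_rpow_of_nonneg ha hr1.le]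
  filter_upwards [ae_restrict_mem measurableSet_Ioo] with t ht
  exact Real.rpow_nonneg ht.1.le r

theorem lintegral_rpow_indicator_lt {r : ℝ} (hr : -1 < r) (a : ℝ≥0∞) :
    ∫⁻ t in Ioi (0 : ℝ), {t : ℝ | ENNReal.ofReal t < a}.indicator
      (fun t => ENNReal.ofReal (t ^ r)) t = (ENNReal.ofReal (r + 1))⁻¹ * a ^ (r + 1) := by
  have hr1 : 0 < r + 1 := by linarith
  have hm : ∀ a : ℝ≥0∞, MeasurableSet {t : ℝ | ENNReal.ofReal t < a} := fun a =>
    measurableSet_lt (by fun_prop) (by fun_prop)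
  have hfin : ∀ b : ℝ≥0, ∫⁻ t in Ioi (0 : ℝ), {t : ℝ | ENNReal.ofReal t < b}.indicator
      (fun t => ENNReal.ofReal (t ^ r)) t = (ENNReal.ofReal (r + 1))⁻¹ * (b : ℝ≥0∞) ^ (r + 1) := by
    intro b
    rw [lintegral_indicator (hm b), Measure.restrict_restrict (hm b)]
    have : {t : ℝ | ENNReal.ofReal t < b} ∩ Ioi 0 = Ioo 0 (b : ℝ) := by
      ext t
      simp only [mem_inter_iff, mem_ofPred_eq, mem_Ioi, mem_Ioo]
      rw [and_comm]
      refine and_congr_right fun ht => ?_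
      rw [← ENNReal.ofReal_coe_nnreal, ENNReal.ofReal_lt_ofReal_iff_of_nonneg ht.le]
    rw [this, setLIntegral_rpow_Ioo hr b.coe_nonneg, ENNReal.ofReal_coe_nnreal]
  induction a with
  | coe b => exact hfin b
  | top =>
    -- At `a = ∞` the integral dominates its value at every finite `b`, so it cannot be finite.
    rw [ENNReal.top_rpow_of_pos hr1, ENNReal.mul_top (by simp), eq_top_iff]
    have hle : ∀ b : ℝ≥0, (ENNReal.ofReal (r + 1))⁻¹ * (b : ℝ≥0∞) ^ (r + 1) ≤
        ∫⁻ t in Ioi (0 : ℝ), {t : ℝ | ENNReal.ofReal t < ∞}.indicator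
          (fun t => ENNReal.ofReal (t ^ r)) t := by
      intro b
      rw [← hfin b]
      refine lintegral_mono fun t => indicator_le_indicator_of_subset ?_ (fun _ => zero_le) t
      intro t _
      exact ENNReal.ofReal_lt_top
    by_contra hcon
    set I := ∫⁻ t in Ioi (0 : ℝ), {t : ℝ | ENNReal.ofReal t < ∞}.indicator
          (fun t => ENNReal.ofReal (t ^ r)) t with hI
    have hIT : I ≠ ∞ := fun h => hcon (by rw [h])
    have hc0 : ENNReal.ofReal (r + 1) ≠ 0 := by simpa using hr1
    have hcT : ENNReal.ofReal (r + 1) ≠ ∞ := ENNReal.ofReal_ne_top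
    have hb : ∀ b : ℝ≥0, (b : ℝ≥0∞) ≤ (ENNReal.ofReal (r + 1) * I) ^ (r + 1)⁻¹ := by
      intro b
      rw [ENNReal.le_rpow_inv_iff hr1]
      calc (b : ℝ≥0∞) ^ (r + 1)
          = ENNReal.ofReal (r + 1) * ((ENNReal.ofReal (r + 1))⁻¹ * (b : ℝ≥0∞) ^ (r + 1)) := by
            rw [← mul_assoc, ENNReal.mul_inv_cancel hc0 hcT, one_mul]
        _ ≤ _ := by gcongr; exact hle b
    have : (ENNReal.ofReal (r + 1) * I) ^ (r + 1)⁻¹ ≠ ∞ :=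
      ENNReal.rpow_ne_top_of_nonneg (by positivity) (ENNReal.mul_ne_top hcT hIT)
    lift (ENNReal.ofReal (r + 1) * I) ^ (r + 1)⁻¹ to ℝ≥0 using this with c
    have := hb (c + 1)
    norm_cast at this
    exact absurd this (not_le.2 (by simp))

/-- Layer cake formula with a density. -/
theorem lintegral_rpow_mul_setLIntegral {ν : Measure X} [SFinite ν] {a b : X → ℝ≥0∞}
    (ha : Measurable a) (hb : Measurable b) {r : ℝ} (hr : -1 < r) :
    ∫⁻ t in Ioi (0 : ℝ), ENNReal.ofReal (t ^ r) * ∫⁻ x in {x | ENNReal.ofReal t < a x}, b x ∂ν =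
      (ENNReal.ofReal (r + 1))⁻¹ * ∫⁻ x, b x * a x ^ (r + 1) ∂ν := by
  have hS : MeasurableSet {z : ℝ × X | ENNReal.ofReal z.1 < a z.2} :=
    measurableSet_lt (by fun_prop) (by fun_prop)
  have h1 : ∀ t : ℝ, ENNReal.ofReal (t ^ r) * ∫⁻ x in {x | ENNReal.ofReal t < a x}, b x ∂ν =
      ∫⁻ x, {z : ℝ × X | ENNReal.ofReal z.1 < a z.2}.indicator
        (fun z => ENNReal.ofReal (z.1 ^ r) * b z.2) (t, x) ∂ν := by
    intro t
    rw [← lintegral_indicator (measurableSet_lt (by fun_prop) (by fun_prop)),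
      ← lintegral_const_mul' _ _ ENNReal.ofReal_ne_top]
    refine lintegral_congr fun x => ?_
    by_cases h : ENNReal.ofReal t < a x <;> simp [indicator, h]
  simp_rw [h1]
  rw [lintegral_lintegral_swap, ← lintegral_const_mul _ (by fun_prop)]
  · refine lintegral_congr fun x => ?_
    calc _ = ∫⁻ t in Ioi (0 : ℝ), b x * {t : ℝ | ENNReal.ofReal t < a x}.indicator
          (fun t => ENNReal.ofReal (t ^ r)) t := by
          refine lintegral_congr fun t => ?_
          by_cases h : ENNReal.ofReal t < a x <;> simp [indicator, h, mul_comm]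
      _ = _ := by
          rw [lintegral_const_mul, lintegral_rpow_indicator_lt hr]
          · ring
          · exact Measurable.indicator (by fun_prop) (measurableSet_lt (by fun_prop) (by fun_prop))
  · exact (Measurable.indicator (by fun_prop) hS).aemeasurable

theorem lintegral_rpow_eq_layercake {ν : Measure X} [SFinite ν] {a : X → ℝ≥0∞}
    (ha : Measurable a) {q : ℝ} (hq : 0 < q) :
    ENNReal.ofReal q * ∫⁻ t in Ioi (0 : ℝ), ENNReal.ofReal (t ^ (q - 1)) *
      ν {x | ENNReal.ofReal t < a x} = ∫⁻ x, a x ^ q ∂ν := by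
  have := lintegral_rpow_mul_setLIntegral (ν := ν) ha (measurable_const (a := (1 : ℝ≥0∞)))
    (r := q - 1) (by linarith)
  simp only [lintegral_const, one_mul, Measure.restrict_apply_univ, sub_add_cancel] at this
  rw [this, ← mul_assoc, ENNReal.mul_inv_cancel (by simpa using hq) ENNReal.ofReal_ne_top, one_mul]

/-- A measurable majorant with the same distribution function. -/
theorem exists_measurable_ge_distribution_eq (ν : Measure X) (h : X → ℝ≥0∞) :
    ∃ G : X → ℝ≥0∞, Measurable G ∧ h ≤ G ∧ ∀ t, ν {x | t < G x} = ν {x | t < h x} := by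
  obtain ⟨s, hsc, hsd⟩ := TopologicalSpace.exists_countable_dense ℝ≥0∞
  -- A countable dense set of levels suffices to rebuild `h` from its superlevel sets, each replaced
  -- by its measurable hull.
  let G : X → ℝ≥0∞ := fun x => ⨆ q ∈ s, (toMeasurable ν {x | q < h x}).indicator (fun _ => q) x
  have hG : h ≤ G := by
    intro x
    by_contra! hlt
    obtain ⟨q, hqs, hq1, hq2⟩ := hsd.exists_between hlt
    refine absurd hq1 (not_lt.2 (le_iSup₂_of_le q hqs ?_))
    have hx : x ∈ toMeasurable ν {x | q < h x} := subset_toMeasurable _ _ hq2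
    rw [indicator_of_mem hx]
  refine ⟨G, ?_, hG, fun t => le_antisymm ?_ (measure_mono fun x hx => lt_of_lt_of_le hx (hG x))⟩
  · exact Measurable.biSup s hsc fun q _ =>
      measurable_const.indicator (measurableSet_toMeasurable _ _)
  · have hsub : {x | t < G x} ⊆ ⋃ q ∈ s ∩ Ioi t, toMeasurable ν {x | q < h x} := by
      intro x hx
      obtain ⟨q, hq, hlt⟩ : ∃ q ∈ s, t < (toMeasurable ν {x | q < h x}).indicator
          (fun _ => q) x := by
        simpa [G, lt_iSup_iff] using hx
      by_cases hxq : x ∈ toMeasurable ν {x | q < h x}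
      · rw [indicator_of_mem hxq] at hlt
        exact mem_biUnion (show q ∈ s ∩ Ioi t from ⟨hq, hlt⟩) hxq
      · rw [indicator_of_notMem hxq] at hlt
        exact absurd hlt not_lt_zero
    refine (measure_mono hsub).trans ?_
    -- A countable union of measurable hulls has the outer measure of the union of the original
    -- sets, so nothing is lost.
    rw [measure_biUnion_toMeasurable (hsc.mono inter_subset_left)]
    refine measure_mono (iUnion₂_subset fun q hq x hx => ?_)
    have hx : q < h x := hx
    exact lt_trans hq.2 hx

/-! ### Weak type and Marcinkiewicz interpolation -/

/-- The weak type `(1, 1)` estimate for the maximal function of the measure `ν`. -/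
def HasWeakType (ν : Measure X) (𝓑 : Set (Set X)) (Λ : ℝ≥0∞) : Prop :=
  ∀ g : X → ℝ≥0∞, Measurable g → ∀ t, t * ν {x | t < maximalFn ν 𝓑 g x} ≤ Λ * ∫⁻ x, g x ∂ν

/-- The constant of the Marcinkiewicz interpolation theorem. -/
noncomputable def strongConst (q : ℝ) : ℝ≥0∞ :=
  ENNReal.ofReal q * (2 * ((ENNReal.ofReal (q - 1))⁻¹ * 2 ^ (q - 1)))

theorem strongConst_ne_top {q : ℝ} (hq : 1 < q) : strongConst q ≠ ∞ := by
  have h1 : (ENNReal.ofReal (q - 1))⁻¹ ≠ ∞ := by simpa using hq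
  have h2 : (2 : ℝ≥0∞) ^ (q - 1) ≠ ∞ := ENNReal.rpow_ne_top_of_nonneg (by linarith) (by simp)
  exact ENNReal.mul_ne_top ENNReal.ofReal_ne_top
    (ENNReal.mul_ne_top (by simp) (ENNReal.mul_ne_top h1 h2))

/-- Pointwise `g` is at most its part above height `s` plus `s`, and the mean of the constant `s` is
at most `s`. -/
theorem maximalFn_le_maximalFn_indicator_add (ν : Measure X) (𝓑 : Set (Set X)) {g : X → ℝ≥0∞}
    (hg : Measurable g) (s : ℝ≥0∞) (x : X) :
    maximalFn ν 𝓑 g x ≤ maximalFn ν 𝓑 ({y | s < g y}.indicator g) x + s := by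
  refine maximalFn_le fun B hB hx => ?_
  have hm : Measurable ({y | s < g y}.indicator g) :=
    hg.indicator (measurableSet_lt measurable_const hg)
  calc (ν B)⁻¹ * ∫⁻ y in B, g y ∂ν
      ≤ (ν B)⁻¹ * ∫⁻ y in B, ({y | s < g y}.indicator g y + s) ∂ν := by
        gcongr with y
        by_cases h : s < g y
        · simp [indicator, h]
        · exact (not_lt.1 h).trans le_add_self
    _ = (ν B)⁻¹ * ∫⁻ y in B, {y | s < g y}.indicator g y ∂ν + s * ((ν B)⁻¹ * ν B) := by
        rw [lintegral_add_left hm, lintegral_const, Measure.restrict_apply_univ]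
        ring
    _ ≤ _ := by
        refine add_le_add (le_maximalFn _ hB hx) ?_
        exact (mul_le_mul_right (ENNReal.inv_mul_le_one _) s).trans_eq (mul_one s)

/-- Marcinkiewicz interpolation with the trivial `L^∞` bound: at level `t`, apply the weak type to
the part of `g` above `t / 2` and integrate in `t`. The layer cake with exponent `q - 2` needs `q >
1`. -/
theorem HasWeakType.exists_majorant {ν : Measure X} [SFinite ν] {𝓑 : Set (Set X)} {Λ : ℝ≥0∞}
    (h : HasWeakType ν 𝓑 Λ) {q : ℝ} (hq : 1 < q) {g : X → ℝ≥0∞} (hg : Measurable g) :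
    ∃ G : X → ℝ≥0∞, Measurable G ∧ maximalFn ν 𝓑 g ≤ G ∧
      ∫⁻ x, G x ^ q ∂ν ≤ strongConst q * Λ * ∫⁻ x, g x ^ q ∂ν := by
  obtain ⟨G, hG, hle, hdist⟩ := exists_measurable_ge_distribution_eq ν (maximalFn ν 𝓑 g)
  refine ⟨G, hG, hle, ?_⟩
  rw [← lintegral_rpow_eq_layercake hG (by linarith)]
  simp_rw [hdist]
  have key : ∀ t ∈ Ioi (0 : ℝ), ENNReal.ofReal (t ^ (q - 1)) *
      ν {x | ENNReal.ofReal t < maximalFn ν 𝓑 g x} ≤ 2 * Λ * (ENNReal.ofReal (t ^ (q - 2)) *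
        ∫⁻ x in {x | ENNReal.ofReal t < 2 * g x}, g x ∂ν) := by
    intro t ht
    have ht : 0 < t := ht
    set τ := ENNReal.ofReal (t / 2) with hτ
    have hτ2 : ENNReal.ofReal t = 2 * τ := by
      rw [hτ, ← ENNReal.ofReal_ofNat, ← ENNReal.ofReal_mul (by norm_num)]
      congr 1; ring
    have hsub : {x | ENNReal.ofReal t < maximalFn ν 𝓑 g x} ⊆
        {x | τ < maximalFn ν 𝓑 ({y | τ < g y}.indicator g) x} := by
      intro x hx
      have h1 := lt_of_lt_of_le hx (maximalFn_le_maximalFn_indicator_add ν 𝓑 hg τ x)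
      rw [hτ2, two_mul] at h1
      exact lt_of_add_lt_add_right h1
    have hmS : MeasurableSet {y | τ < g y} := measurableSet_lt measurable_const hg
    have hw := h _ (hg.indicator hmS) τ
    rw [lintegral_indicator hmS] at hw
    have hset : {x | ENNReal.ofReal t < 2 * g x} = {y | τ < g y} := by
      ext x
      simp only [mem_ofPred_eq, hτ2]
      exact ENNReal.mul_lt_mul_iff_right (by simp) (by simp)
    rw [hset]
    have hpow : ENNReal.ofReal (t ^ (q - 1)) = ENNReal.ofReal (t ^ (q - 2)) * (2 * τ) := by
      rw [← hτ2, ← ENNReal.ofReal_mul (by positivity), ← Real.rpow_add_one ht.ne']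
      congr 2; ring
    calc _ ≤ ENNReal.ofReal (t ^ (q - 2)) * (2 * τ) *
          ν {x | τ < maximalFn ν 𝓑 ({y | τ < g y}.indicator g) x} := by
          rw [hpow]; gcongr
      _ = ENNReal.ofReal (t ^ (q - 2)) * 2 *
          (τ * ν {x | τ < maximalFn ν 𝓑 ({y | τ < g y}.indicator g) x}) := by ring
      _ ≤ ENNReal.ofReal (t ^ (q - 2)) * 2 * (Λ * ∫⁻ x in {y | τ < g y}, g x ∂ν) := by gcongr
      _ = _ := by ring
  have hΛ : ∫⁻ t in Ioi (0 : ℝ), ENNReal.ofReal (t ^ (q - 1)) *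
      ν {x | ENNReal.ofReal t < maximalFn ν 𝓑 g x} ≤ 2 * Λ * ∫⁻ t in Ioi (0 : ℝ),
        (ENNReal.ofReal (t ^ (q - 2)) * ∫⁻ x in {x | ENNReal.ofReal t < 2 * g x}, g x ∂ν) := by
    refine (setLIntegral_mono' measurableSet_Ioi key).trans_eq ?_
    -- The inner integral is measurable in `t` because the superlevel sets shrink as `t` grows.
    refine lintegral_const_mul _ (Measurable.mul (by fun_prop) (Antitone.measurable ?_))
    intro t t' htt'
    refine lintegral_mono_set fun x hx => ?_
    exact lt_of_le_of_lt (ENNReal.ofReal_le_ofReal htt') hx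
  rw [lintegral_rpow_mul_setLIntegral (by fun_prop) hg (by linarith)] at hΛ
  refine (mul_le_mul_right hΛ _).trans_eq ?_
  have hgg : ∀ x, g x * (2 * g x) ^ (q - 2 + 1) = 2 ^ (q - 1) * g x ^ q := by
    intro x
    have h1 : q - 2 + 1 = q - 1 := by ring
    rw [h1, ENNReal.mul_rpow_of_nonneg _ _ (by linarith), mul_left_comm]
    congr 1
    conv_lhs => rw [← ENNReal.rpow_one (g x), ← ENNReal.rpow_mul, one_mul,
      ← ENNReal.rpow_add_of_nonneg _ _ (by norm_num) (by linarith)]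
    congr 1; ring
  simp_rw [hgg]
  rw [lintegral_const_mul _ (by fun_prop), strongConst, show q - 2 + 1 = q - 1 by ring]
  ring

/-- By (B3) for the whole space, countably many balls cover everything up to a set of finite
measure. -/
theorem IsBallBasis.sigmaFinite {μ : Measure X} {𝓑 : Set (Set X)} {hull : Set X → Set X} {K : ℝ}
    (h : IsBallBasis μ 𝓑 hull K) : SigmaFinite μ := by
  obtain ⟨𝒞, hsub, hcount, hμ⟩ := h.approx univ MeasurableSet.univ 1 one_pos
  refine Measure.sigmaFinite_of_countable (S := insert (⋃₀ 𝒞)ᶜ 𝒞) (hcount.insert _) ?_ ?_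
  · rintro s (rfl | hs)
    · refine lt_of_le_of_lt (measure_mono fun x hx => ?_) (hμ.trans ENNReal.ofReal_lt_top)
      exact Or.inl ⟨mem_univ x, hx⟩
    · exact h.measure_lt_top s (hsub hs)
  · rw [sUnion_insert, compl_union_self]

/-! ### Covering arguments for the weak type -/

section Overlap

variable {ν : Measure X} {𝒜 : Set (Set X)} {D : ℕ}

theorem tsum_setLIntegral_le_of_overlap (hm : ∀ A ∈ 𝒜, MeasurableSet A)
    (hD : ∀ x, {A ∈ 𝒜 | x ∈ A}.encard ≤ D) {g : X → ℝ≥0∞} (hg : Measurable g) :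
    ∑' A : 𝒜, ∫⁻ x in (A : Set X), g x ∂ν ≤ D * ∫⁻ x, g x ∂ν := by
  classical
  rw [ENNReal.tsum_eq_iSup_sum]
  refine iSup_le fun F => ?_
  have h1 : ∀ A : 𝒜, ∫⁻ x in (A : Set X), g x ∂ν = ∫⁻ x, (A : Set X).indicator g x ∂ν :=
    fun A => (lintegral_indicator (hm A A.2) g).symm
  simp_rw [h1]
  rw [← lintegral_finsetSum _ fun (A : 𝒜) _ => hg.indicator (hm A A.2), ← lintegral_const_mul _ hg]
  refine lintegral_mono fun x => ?_
  simp only [indicator_apply]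
  rw [← Finset.sum_filter, Finset.sum_const, nsmul_eq_mul]
  gcongr
  have h2 : (((F.filter fun A : 𝒜 => x ∈ (A : Set X)).image Subtype.val : Finset (Set X)) :
      Set (Set X)).encard ≤ D := by
    refine (encard_le_encard ?_).trans (hD x)
    intro A hA
    simp only [Finset.coe_image, Finset.coe_filter, mem_image] at hA
    obtain ⟨A, hA, rfl⟩ := hA
    exact ⟨A.2, hA.2⟩
  rw [encard_coe_eq_coe_finsetCard, Finset.card_image_of_injective _ Subtype.val_injective] at h2
  exact_mod_cast h2

/-- On each spanning set of finite measure, the measures of the traces have a sum at most `D` times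
that of the set, so only countably many traces are non-null. -/
theorem countable_of_overlap [SigmaFinite ν] (hm : ∀ A ∈ 𝒜, MeasurableSet A)
    (h0 : ∀ A ∈ 𝒜, ν A ≠ 0) (hD : ∀ x, {A ∈ 𝒜 | x ∈ A}.encard ≤ D) : 𝒜.Countable := by
  have hS := measurableSet_spanningSets ν
  have key : ∀ n, {A : 𝒜 | ν (A ∩ spanningSets ν n) ≠ 0}.Countable := by
    intro n
    have h1 := tsum_setLIntegral_le_of_overlap (ν := ν) hm hD
      ((measurable_const (a := (1 : ℝ≥0∞))).indicator (hS n))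
    simp only [lintegral_indicator (hS n), lintegral_const, one_mul, Measure.restrict_apply_univ,
      Measure.restrict_restrict (hS n)] at h1
    have h2 := Summable.countable_support_ennreal (h1.trans_lt (ENNReal.mul_lt_top
      (ENNReal.natCast_lt_top D) (measure_spanningSets_lt_top ν n))).ne
    refine h2.mono fun A hA => ?_
    rw [Function.mem_support, inter_comm]
    exact hA
  have hall : (univ : Set 𝒜).Countable := by
    refine (countable_iUnion key).mono fun A _ => ?_
    by_contra hcon
    simp only [mem_iUnion, not_exists] at hcon
    apply h0 A A.2
    have : (A : Set X) = ⋃ n, (A : Set X) ∩ spanningSets ν n := by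
      rw [← inter_iUnion, iUnion_spanningSets, inter_univ]
    rw [this, measure_iUnion_null_iff]
    intro n
    by_contra hn
    exact hcon n hn
  exact countable_coe_iff.1 (countable_univ_iff.1 hall)

/-- Weak type estimate for a union of enlargements of balls of bounded overlap. -/
theorem mul_measure_biUnion_le_of_overlap [SigmaFinite ν] (hm : ∀ A ∈ 𝒜, MeasurableSet A)
    (h0 : ∀ A ∈ 𝒜, ν A ≠ 0) (hD : ∀ x, {A ∈ 𝒜 | x ∈ A}.encard ≤ D) {g : X → ℝ≥0∞}
    (hg : Measurable g) {t Λ : ℝ≥0∞} (ht : ∀ A ∈ 𝒜, t * ν A ≤ ∫⁻ x in A, g x ∂ν)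
    {e : Set X → Set X} (he : ∀ A ∈ 𝒜, ν (e A) ≤ Λ * ν A) :
    t * ν (⋃ A ∈ 𝒜, e A) ≤ Λ * D * ∫⁻ x, g x ∂ν := by
  have hc := countable_of_overlap hm h0 hD
  calc t * ν (⋃ A ∈ 𝒜, e A) ≤ t * ∑' A : 𝒜, ν (e A) := by
        gcongr; exact measure_biUnion_le ν hc e
    _ = ∑' A : 𝒜, t * ν (e A) := ENNReal.tsum_mul_left.symm
    _ ≤ ∑' A : 𝒜, Λ * ∫⁻ x in (A : Set X), g x ∂ν := by
        refine ENNReal.tsum_le_tsum fun A => ?_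
        calc t * ν (e A) ≤ t * (Λ * ν A) := by gcongr; exact he A A.2
          _ = Λ * (t * ν A) := by ring
          _ ≤ _ := by gcongr; exact ht A A.2
    _ = Λ * ∑' A : 𝒜, ∫⁻ x in (A : Set X), g x ∂ν := ENNReal.tsum_mul_left
    _ ≤ _ := by rw [mul_assoc]; gcongr; exact tsum_setLIntegral_le_of_overlap hm hD hg

end Overlap

theorem exists_ball_of_lt_maximalFn {ν : Measure X} {𝓑 : Set (Set X)} (h0 : ∀ B ∈ 𝓑, ν B ≠ 0)
    (hT : ∀ B ∈ 𝓑, ν B ≠ ∞) {g : X → ℝ≥0∞} {t : ℝ≥0∞} {x : X} (h : t < maximalFn ν 𝓑 g x) :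
    ∃ B ∈ 𝓑, x ∈ B ∧ t * ν B < ∫⁻ y in B, g y ∂ν := by
  simp only [maximalFn, lt_iSup_iff] at h
  obtain ⟨B, hB, hx, hlt⟩ := h
  refine ⟨B, hB, hx, ?_⟩
  rw [← ENNReal.div_eq_inv_mul, ENNReal.lt_div_iff_mul_lt (Or.inl (h0 B hB)) (Or.inl (hT B hB))]
    at hlt
  exact hlt

theorem IsBesicovitch.hasWeakType {ν : Measure X} [SigmaFinite ν] {𝓑 : Set (Set X)} {D : ℕ}
    (hD : IsBesicovitch 𝓑 D) (hm : ∀ B ∈ 𝓑, MeasurableSet B) (h0 : ∀ B ∈ 𝓑, ν B ≠ 0)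
    (hT : ∀ B ∈ 𝓑, ν B ≠ ∞) : HasWeakType ν 𝓑 D := by
  intro g hg t
  obtain ⟨𝒜, h𝒜, hU, hov⟩ := hD {B ∈ 𝓑 | t * ν B < ∫⁻ y in B, g y ∂ν} (sep_subset _ _)
  have hsub : {x | t < maximalFn ν 𝓑 g x} ⊆ ⋃ A ∈ 𝒜, id A := by
    intro x hx
    obtain ⟨B, hB, hxB, hlt⟩ := exists_ball_of_lt_maximalFn h0 hT hx
    have : x ∈ ⋃₀ {B ∈ 𝓑 | t * ν B < ∫⁻ y in B, g y ∂ν} := ⟨B, ⟨hB, hlt⟩, hxB⟩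
    rw [← hU, sUnion_eq_biUnion] at this
    exact this
  have := mul_measure_biUnion_le_of_overlap (Λ := 1) (e := id) (fun A hA => hm A (h𝒜 hA).1)
    (fun A hA => h0 A (h𝒜 hA).1) hov hg (fun A hA => (h𝒜 hA).2.le) (fun A _ => by simp)
  rw [one_mul] at this
  exact (mul_le_mul_right (measure_mono hsub) t).trans this

/-- Vitali selection is by `μ`-size, where hulls are controlled: every ball of the family lies in
the hull of a selected one. The measure `ν` enters only through its doubling constant `Λ`. -/
theorem IsBallBasis.hasWeakType {μ ν : Measure X} [SigmaFinite ν] {𝓑 : Set (Set X)}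
    {hull : Set X → Set X} {K : ℝ} (h : IsBallBasis μ 𝓑 hull K) (h0 : ∀ B ∈ 𝓑, ν B ≠ 0)
    (hT : ∀ B ∈ 𝓑, ν B ≠ ∞) {Λ : ℝ≥0∞} (hΛ : ∀ B ∈ 𝓑, ν (hull B) ≤ Λ * ν B) :
    HasWeakType ν 𝓑 Λ := by
  intro g hg t
  -- Vitali's lemma needs bounded sizes; the truncation `μ B ≤ n` is removed by monotone continuity
  -- of the outer measure.
  let 𝒜 : ℕ → Set (Set X) := fun n => {B ∈ 𝓑 | t * ν B < ∫⁻ y in B, g y ∂ν ∧ μ B ≤ n}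
  have hmono : Monotone fun n => ⋃₀ 𝒜 n := by
    intro m n hmn
    refine sUnion_subset_sUnion fun B hB => ⟨hB.1, hB.2.1, hB.2.2.trans ?_⟩
    exact_mod_cast hmn
  have hsub : {x | t < maximalFn ν 𝓑 g x} ⊆ ⋃ n, ⋃₀ 𝒜 n := by
    intro x hx
    obtain ⟨B, hB, hxB, hlt⟩ := exists_ball_of_lt_maximalFn h0 hT hx
    obtain ⟨n, hn⟩ := ENNReal.exists_nat_gt (h.measure_ne_top hB)
    exact mem_iUnion.2 ⟨n, B, ⟨hB, hlt, hn.le⟩, hxB⟩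
  refine (mul_le_mul_right (measure_mono hsub) t).trans ?_
  rw [hmono.measure_iUnion, ENNReal.mul_iSup]
  refine iSup_le fun n => ?_
  obtain ⟨u, hu, hdisj, hcov⟩ := Vitali.exists_disjoint_subfamily_covering_enlargement
    (fun B : Set X => B) (𝒜 n) (fun B => (μ B).toReal) 2 one_lt_two
    (fun _ _ => ENNReal.toReal_nonneg) n
    (fun B hB => ENNReal.toReal_le_of_le_ofReal (Nat.cast_nonneg n) (by simpa using hB.2.2))
    (fun B hB => h.nonempty hB.1)
  have hcov' : ⋃₀ 𝒜 n ⊆ ⋃ B ∈ u, hull B := by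
    rintro x ⟨A, hA, hxA⟩
    obtain ⟨B, hB, hAB, hle⟩ := hcov A hA
    have hB𝓑 := (hu hB).1
    refine mem_biUnion hB (h.subset_hull_of_le hA.1 hB𝓑 ?_ hAB hxA)
    rw [← ENNReal.toReal_le_toReal (h.measure_ne_top hA.1)
      (ENNReal.mul_ne_top (by simp) (h.measure_ne_top hB𝓑)), ENNReal.toReal_mul]
    simpa using hle
  have hov : ∀ x, {A ∈ u | x ∈ A}.encard ≤ (1 : ℕ) := by
    intro x
    rw [Nat.cast_one, encard_le_one_iff]
    intro A B hA hB
    by_contra hne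
    exact (disjoint_left.1 (hdisj hA.1 hB.1 hne)) hA.2 hB.2
  have := mul_measure_biUnion_le_of_overlap (Λ := Λ) (e := hull)
    (fun A hA => h.measurableSet A (hu hA).1) (fun A hA => h0 A (hu hA).1) hov hg
    (fun A hA => (hu hA).2.1.le) (fun A hA => hΛ A (hu hA).1)
  rw [Nat.cast_one, mul_one] at this
  exact (mul_le_mul_right (measure_mono hcov') t).trans this

/-! ### Muckenhoupt pairs and the pointwise bound -/

/-- An everywhere positive and finite measurable density `W` and its dual density `S`, with the
`A_p` condition (with bound `Q`) on the members of `𝓑`. -/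
structure IsApPair (μ : Measure X) (𝓑 : Set (Set X)) (p : ℝ) (Q : ℝ≥0∞) (W S : X → ℝ≥0∞) :
    Prop where
  measurable_left : Measurable W
  measurable_right : Measurable S
  left_ne_zero : ∀ x, W x ≠ 0
  left_ne_top : ∀ x, W x ≠ ∞
  right_eq : ∀ x, S x = W x ^ (-1 / (p - 1))
  one_lt : 1 < p
  bound_ne_top : Q ≠ ∞
  measurableSet : ∀ B ∈ 𝓑, MeasurableSet B
  measure_ne_zero : ∀ B ∈ 𝓑, μ B ≠ 0
  measure_ne_top : ∀ B ∈ 𝓑, μ B ≠ ∞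
  bound : ∀ B ∈ 𝓑, ((μ B)⁻¹ * μ.withDensity W B) * ((μ B)⁻¹ * μ.withDensity S B) ^ (p - 1) ≤ Q

namespace IsApPair

variable {μ : Measure X} {𝓑 : Set (Set X)} {p : ℝ} {Q : ℝ≥0∞} {W S : X → ℝ≥0∞}

theorem right_ne_zero (h : IsApPair μ 𝓑 p Q W S) (x : X) : S x ≠ 0 := by
  rw [h.right_eq]
  exact (ENNReal.rpow_pos (h.left_ne_zero x).bot_lt (h.left_ne_top x)).ne'

theorem right_ne_top (h : IsApPair μ 𝓑 p Q W S) (x : X) : S x ≠ ∞ := by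
  rw [h.right_eq]
  exact ENNReal.rpow_ne_top_of_ne_zero (h.left_ne_zero x) (h.left_ne_top x)

/-- Hölder's inequality on `B` for `1 = W^(1/p) * S^(1/p')`. -/
theorem measure_rpow_le (h : IsApPair μ 𝓑 p Q W S) {B : Set X} (hB : B ∈ 𝓑) :
    μ B ^ p ≤ μ.withDensity W B * μ.withDensity S B ^ (p - 1) := by
  have hp := h.one_lt
  have hp0 : (0 : ℝ) < p := by linarith
  have hp1 : p - 1 ≠ 0 := by linarith
  have hc : p.HolderConjugate (p / (p - 1)) := Real.HolderConjugate.conjExponent hp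
  have hH := ENNReal.lintegral_mul_le_Lp_mul_Lq (μ.restrict B) hc
    (f := fun x => W x ^ (1 / p)) (g := fun x => S x ^ (1 / (p / (p - 1))))
    (h.measurable_left.pow_const _).aemeasurable (h.measurable_right.pow_const _).aemeasurable
  have h1 : ∀ x, ((fun x => W x ^ (1 / p)) * fun x => S x ^ (1 / (p / (p - 1)))) x = 1 := by
    intro x
    rw [Pi.mul_apply, h.right_eq, ← ENNReal.rpow_mul,
      ← ENNReal.rpow_add _ _ (h.left_ne_zero x) (h.left_ne_top x)]
    rw [show 1 / p + -1 / (p - 1) * (1 / (p / (p - 1))) = 0 by field_simp; ring, ENNReal.rpow_zero]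
  have hr : ∀ (a : ℝ≥0∞) (r : ℝ), r ≠ 0 → (a ^ (1 / r)) ^ r = a := fun a r hr => by
    rw [← ENNReal.rpow_mul, one_div_mul_cancel hr, ENNReal.rpow_one]
  simp only [h1, hr _ p hp0.ne', hr _ (p / (p - 1)) (by positivity), lintegral_const, one_mul,
    Measure.restrict_apply_univ] at hH
  rw [withDensity_apply _ (h.measurableSet B hB), withDensity_apply _ (h.measurableSet B hB)]
  calc μ B ^ p ≤ _ := ENNReal.rpow_le_rpow hH hp0.le
    _ = _ := by
      rw [ENNReal.mul_rpow_of_nonneg _ _ hp0.le, hr _ p hp0.ne', ← ENNReal.rpow_mul]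
      congr 2
      field_simp

theorem le_measure_rpow (h : IsApPair μ 𝓑 p Q W S) {B : Set X} (hB : B ∈ 𝓑) :
    μ.withDensity W B * μ.withDensity S B ^ (p - 1) ≤ Q * μ B ^ p := by
  have hp := h.one_lt
  have h0 := h.measure_ne_zero B hB
  have hT := h.measure_ne_top B hB
  calc _ = (μ B * (μ B)⁻¹ * μ.withDensity W B) *
        (μ B * (μ B)⁻¹ * μ.withDensity S B) ^ (p - 1) := by
        rw [ENNReal.mul_inv_cancel h0 hT, one_mul, one_mul]
    _ = ((μ B)⁻¹ * μ.withDensity W B) * ((μ B)⁻¹ * μ.withDensity S B) ^ (p - 1) *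
        (μ B * μ B ^ (p - 1)) := by
        rw [mul_assoc (μ B) _ (μ.withDensity S B), ENNReal.mul_rpow_of_nonneg (μ B) _ (by linarith)]
        ring
    _ ≤ Q * (μ B * μ B ^ (p - 1)) := by gcongr; exact h.bound B hB
    _ = Q * μ B ^ p := by
        congr 1
        conv_lhs => rw [← ENNReal.rpow_one (μ B), ← ENNReal.rpow_mul, one_mul,
          ← ENNReal.rpow_add _ _ h0 hT]
        congr 1; ring

theorem one_le_bound (h : IsApPair μ 𝓑 p Q W S) {B : Set X} (hB : B ∈ 𝓑) : 1 ≤ Q := by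
  have hp0 : (0 : ℝ) < p := by linarith [h.one_lt]
  have h1 := (h.measure_rpow_le hB).trans (h.le_measure_rpow hB)
  have h0 : μ B ^ p ≠ 0 := by simp [h.measure_ne_zero B hB, hp0, hp0.le]
  have hT : μ B ^ p ≠ ∞ := ENNReal.rpow_ne_top_of_nonneg hp0.le (h.measure_ne_top B hB)
  rw [mul_comm] at h1
  exact (ENNReal.mul_le_mul_iff_right h0 hT).1 (by rwa [mul_one])

/-- With `mul_ne_top`, this places the product in `(0, ∞)`, which forces each factor to be positive
and finite. -/
theorem mul_ne_zero (h : IsApPair μ 𝓑 p Q W S) {B : Set X} (hB : B ∈ 𝓑) :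
    μ.withDensity W B * μ.withDensity S B ^ (p - 1) ≠ 0 := by
  have hp0 : (0 : ℝ) < p := by linarith [h.one_lt]
  intro h0
  have h1 := h.measure_rpow_le hB
  rw [h0] at h1
  simp [h.measure_ne_zero B hB, h.measure_ne_top B hB] at h1

theorem mul_ne_top (h : IsApPair μ 𝓑 p Q W S) {B : Set X} (hB : B ∈ 𝓑) :
    μ.withDensity W B * μ.withDensity S B ^ (p - 1) ≠ ∞ :=
  ((h.le_measure_rpow hB).trans_lt (ENNReal.mul_lt_top h.bound_ne_top.lt_top
    (ENNReal.rpow_lt_top_of_nonneg (by linarith [h.one_lt]) (h.measure_ne_top B hB)))).ne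

theorem left_measure_ne_zero (h : IsApPair μ 𝓑 p Q W S) {B : Set X} (hB : B ∈ 𝓑) :
    μ.withDensity W B ≠ 0 := left_ne_zero_of_mul (h.mul_ne_zero hB)

theorem right_measure_rpow_ne_zero (h : IsApPair μ 𝓑 p Q W S) {B : Set X} (hB : B ∈ 𝓑) :
    μ.withDensity S B ^ (p - 1) ≠ 0 := right_ne_zero_of_mul (h.mul_ne_zero hB)

theorem left_measure_ne_top (h : IsApPair μ 𝓑 p Q W S) {B : Set X} (hB : B ∈ 𝓑) :
    μ.withDensity W B ≠ ∞ := by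
  intro hT
  apply h.mul_ne_top hB
  rw [hT, ENNReal.top_mul (h.right_measure_rpow_ne_zero hB)]

theorem right_measure_rpow_ne_top (h : IsApPair μ 𝓑 p Q W S) {B : Set X} (hB : B ∈ 𝓑) :
    μ.withDensity S B ^ (p - 1) ≠ ∞ := by
  intro hT
  apply h.mul_ne_top hB
  rw [hT, ENNReal.mul_top (h.left_measure_ne_zero hB)]

theorem right_measure_ne_zero (h : IsApPair μ 𝓑 p Q W S) {B : Set X} (hB : B ∈ 𝓑) :
    μ.withDensity S B ≠ 0 := by
  intro h0
  apply h.right_measure_rpow_ne_zero hB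
  rw [h0, ENNReal.zero_rpow_of_pos (by linarith [h.one_lt])]

theorem right_measure_ne_top (h : IsApPair μ 𝓑 p Q W S) {B : Set X} (hB : B ∈ 𝓑) :
    μ.withDensity S B ≠ ∞ := by
  intro hT
  apply h.right_measure_rpow_ne_top hB
  rw [hT, ENNReal.top_rpow_of_pos (by linarith [h.one_lt])]

variable {hull : Set X → Set X} {K : ℝ}

theorem mul_hull_le (h : IsApPair μ 𝓑 p Q W S) (hb : IsBallBasis μ 𝓑 hull K) {B : Set X}
    (hB : B ∈ 𝓑) : μ.withDensity W (hull B) * μ.withDensity S (hull B) ^ (p - 1) ≤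
      Q * ENNReal.ofReal K ^ p * (μ.withDensity W B * μ.withDensity S B ^ (p - 1)) := by
  have hp0 : (0 : ℝ) ≤ p := by linarith [h.one_lt]
  calc _ ≤ Q * μ (hull B) ^ p := h.le_measure_rpow (hb.hull_mem B hB)
    _ ≤ Q * (ENNReal.ofReal K * μ B) ^ p := by
        gcongr; exact hb.measure_hull_le B hB
    _ = Q * ENNReal.ofReal K ^ p * μ B ^ p := by
        rw [ENNReal.mul_rpow_of_nonneg _ _ hp0, mul_assoc]
    _ ≤ _ := by gcongr; exact h.measure_rpow_le hB

/-- The product in `mul_hull_le` doubles with constant `Q * K^p`; bounding the `S` factor on the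
hull below by its value on `B` lets it cancel. -/
theorem left_measure_hull_le (h : IsApPair μ 𝓑 p Q W S) (hb : IsBallBasis μ 𝓑 hull K)
    {B : Set X} (hB : B ∈ 𝓑) :
    μ.withDensity W (hull B) ≤ Q * ENNReal.ofReal K ^ p * μ.withDensity W B := by
  have hp := h.one_lt
  rw [← ENNReal.mul_le_mul_iff_right (h.right_measure_rpow_ne_zero hB)
    (h.right_measure_rpow_ne_top hB)]
  calc μ.withDensity S B ^ (p - 1) * μ.withDensity W (hull B)
      ≤ μ.withDensity S (hull B) ^ (p - 1) * μ.withDensity W (hull B) := by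
        gcongr
        exact hb.subset_hull_self hB
    _ = μ.withDensity W (hull B) * μ.withDensity S (hull B) ^ (p - 1) := mul_comm _ _
    _ ≤ _ := h.mul_hull_le hb hB
    _ = _ := by ring

theorem right_measure_hull_le (h : IsApPair μ 𝓑 p Q W S) (hb : IsBallBasis μ 𝓑 hull K)
    {B : Set X} (hB : B ∈ 𝓑) : μ.withDensity S (hull B) ≤
      (Q * ENNReal.ofReal K ^ p) ^ (1 / (p - 1)) * μ.withDensity S B := by
  have hp : 0 < p - 1 := by linarith [h.one_lt]
  have hr : ∀ a : ℝ≥0∞, (a ^ (1 / (p - 1))) ^ (p - 1) = a := fun a => by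
    rw [← ENNReal.rpow_mul, one_div_mul_cancel hp.ne', ENNReal.rpow_one]
  rw [← ENNReal.rpow_le_rpow_iff hp, ENNReal.mul_rpow_of_nonneg _ _ hp.le, hr,
    ← ENNReal.mul_le_mul_iff_right (h.left_measure_ne_zero hB) (h.left_measure_ne_top hB)]
  calc μ.withDensity W B * μ.withDensity S (hull B) ^ (p - 1)
      ≤ μ.withDensity W (hull B) * μ.withDensity S (hull B) ^ (p - 1) := by
        gcongr
        exact hb.subset_hull_self hB
    _ ≤ _ := h.mul_hull_le hb hB
    _ = _ := by ring

/-- Write `a = ∫_B F dμ`, `s = S(B)`, `v = W(B)`. The `A_p` bound gives `(a / μ B)^(p-1) ≤ Q * v⁻¹ *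
μ B * (a / s)^(p-1)`. Since `a / s` is the `S`-mean of `F / S`, it is at most `G` throughout `B`, so
the right side is at most `Q` times the `W`-mean of `G^(p-1) / W`. -/
theorem lerner_pointwise (h : IsApPair μ 𝓑 p Q W S) {F G : X → ℝ≥0∞} (hF : Measurable F)
    (hG : Measurable G) (hle : maximalFn (μ.withDensity S) 𝓑 (fun x => F x * (S x)⁻¹) ≤ G)
    (x : X) : maximalFn μ 𝓑 F x ≤
      (Q * maximalFn (μ.withDensity W) 𝓑 (fun x => G x ^ (p - 1) * (W x)⁻¹) x) ^ (1 / (p - 1)) := by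
  have hp : 0 < p - 1 := by linarith [h.one_lt]
  refine maximalFn_le fun B hB hx => ?_
  have hmB := h.measurableSet B hB
  have h0 := h.measure_ne_zero B hB
  have hT := h.measure_ne_top B hB
  have hcancel : ∀ (V f : X → ℝ≥0∞), Measurable V → Measurable f → (∀ x, V x ≠ 0) →
      (∀ x, V x ≠ ∞) → ∫⁻ y in B, f y * (V y)⁻¹ ∂(μ.withDensity V) = ∫⁻ y in B, f y ∂μ := by
    intro V f hV hf hV0 hVT
    rw [setLIntegral_withDensity_eq_setLIntegral_mul μ hV (by fun_prop) hmB]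
    refine lintegral_congr fun y => ?_
    rw [Pi.mul_apply, mul_left_comm, ENNReal.mul_inv_cancel (hV0 y) (hVT y), mul_one]
  rw [one_div, ENNReal.le_rpow_inv_iff hp]
  have h1 : ∀ y ∈ B, (μ.withDensity S B)⁻¹ * ∫⁻ y in B, F y ∂μ ≤ G y := by
    intro y hy
    have := (le_maximalFn (μ := μ.withDensity S) (fun x => F x * (S x)⁻¹) hB hy).trans (hle y)
    rwa [hcancel S F h.measurable_right hF h.right_ne_zero h.right_ne_top] at this
  set a := ∫⁻ y in B, F y ∂μ
  set s := μ.withDensity S B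
  set v := μ.withDensity W B
  have h2 : ((s⁻¹ * a) ^ (p - 1)) * μ B ≤ ∫⁻ y in B, G y ^ (p - 1) ∂μ := by
    rw [← setLIntegral_const]
    exact setLIntegral_mono (by fun_prop) fun y hy => ENNReal.rpow_le_rpow (h1 y hy) hp.le
  have h3 : v⁻¹ * (((s⁻¹ * a) ^ (p - 1)) * μ B) ≤
      maximalFn (μ.withDensity W) 𝓑 (fun x => G x ^ (p - 1) * (W x)⁻¹) x := by
    refine le_trans ?_ (le_maximalFn _ hB hx)
    rw [hcancel W _ h.measurable_left (by fun_prop) h.left_ne_zero h.left_ne_top]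
    gcongr
  have h4 : (μ B ^ p)⁻¹ ≤ Q * (v * s ^ (p - 1))⁻¹ :=
    inv_le_mul_inv_of_le_mul (h.le_measure_rpow hB) (h.mul_ne_zero hB) (h.mul_ne_top hB)
  have h5 : ((μ B)⁻¹) ^ (p - 1) = (μ B ^ p)⁻¹ * μ B := by
    conv_rhs => rw [← ENNReal.rpow_neg, ← ENNReal.rpow_one (μ B), ← ENNReal.rpow_mul, one_mul,
      ← ENNReal.rpow_add _ _ h0 hT]
    rw [ENNReal.inv_rpow, ← ENNReal.rpow_neg]
    congr 1; ring
  calc ((μ B)⁻¹ * a) ^ (p - 1) = (μ B ^ p)⁻¹ * μ B * a ^ (p - 1) := by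
        rw [ENNReal.mul_rpow_of_nonneg _ _ hp.le, h5]
    _ ≤ Q * (v * s ^ (p - 1))⁻¹ * μ B * a ^ (p - 1) :=
        mul_le_mul_left (mul_le_mul_left h4 _) _
    _ = Q * (v⁻¹ * (((s⁻¹ * a) ^ (p - 1)) * μ B)) := by
        rw [ENNReal.mul_inv (Or.inl (h.left_measure_ne_zero hB))
          (Or.inl (h.left_measure_ne_top hB)), ENNReal.mul_rpow_of_nonneg _ _ hp.le,
          ENNReal.inv_rpow]
        ring
    _ ≤ _ := mul_le_mul_right h3 Q

theorem exists_majorant [SigmaFinite μ] (h : IsApPair μ 𝓑 p Q W S) {Λ Λ' : ℝ≥0∞}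
    (hW : HasWeakType (μ.withDensity W) 𝓑 Λ) (hS : HasWeakType (μ.withDensity S) 𝓑 Λ')
    {F : X → ℝ≥0∞} (hF : Measurable F) :
    ∃ H : X → ℝ≥0∞, Measurable H ∧ maximalFn μ 𝓑 F ≤ H ∧
      ∫⁻ x, H x ^ p ∂(μ.withDensity W) ≤
        strongConst p * strongConst (p / (p - 1)) * Λ * Λ' * Q ^ (p / (p - 1)) *
          ∫⁻ x, F x ^ p ∂(μ.withDensity W) := by
  have hp := h.one_lt
  have hp1 : 0 < p - 1 := by linarith
  have hp0 : 0 < p := by linarith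
  have hq : 1 < p / (p - 1) := by rw [lt_div_iff₀ hp1]; linarith
  have hWm := h.measurable_left
  have hSm := h.measurable_right
  have := SigmaFinite.withDensity_of_ne_top' (μ := μ) h.left_ne_top
  have := SigmaFinite.withDensity_of_ne_top' (μ := μ) h.right_ne_top
  obtain ⟨G, hG, hGle, hGint⟩ := hS.exists_majorant hp (g := fun x => F x * (S x)⁻¹)
    (by fun_prop)
  obtain ⟨G', hG', hGle', hGint'⟩ := hW.exists_majorant hq
    (g := fun x => G x ^ (p - 1) * (W x)⁻¹) (by fun_prop)
  refine ⟨fun x => (Q * G' x) ^ (1 / (p - 1)), by fun_prop, fun x => ?_, ?_⟩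
  · exact (h.lerner_pointwise hF hG hGle x).trans
      (ENNReal.rpow_le_rpow (mul_le_mul_right (hGle' x) Q) (by positivity))
  -- Here `S^(1-p) = W`.
  have e1 : ∫⁻ x, (F x * (S x)⁻¹) ^ p ∂(μ.withDensity S) =
      ∫⁻ x, F x ^ p ∂(μ.withDensity W) := by
    rw [lintegral_withDensity_eq_lintegral_mul _ hSm (by fun_prop),
      lintegral_withDensity_eq_lintegral_mul _ hWm (by fun_prop)]
    refine lintegral_congr fun x => ?_
    have h0 := h.left_ne_zero x
    have hT := h.left_ne_top x
    rw [Pi.mul_apply, Pi.mul_apply, ENNReal.mul_rpow_of_nonneg _ _ hp0.le, mul_left_comm,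
      mul_comm (W x), h.right_eq, ← ENNReal.rpow_neg, ← ENNReal.rpow_mul,
      ← ENNReal.rpow_add _ _ h0 hT]
    congr 1
    conv_rhs => rw [← ENNReal.rpow_one (W x)]
    congr 1
    field_simp
    ring
  -- Here `W^(1-p') = S`, so the output norm of `M_S` is the input norm of `M_W`.
  have e2 : ∫⁻ x, (G x ^ (p - 1) * (W x)⁻¹) ^ (p / (p - 1)) ∂(μ.withDensity W) =
      ∫⁻ x, G x ^ p ∂(μ.withDensity S) := by
    rw [lintegral_withDensity_eq_lintegral_mul _ hSm (by fun_prop),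
      lintegral_withDensity_eq_lintegral_mul _ hWm (by fun_prop)]
    refine lintegral_congr fun x => ?_
    have h0 := h.left_ne_zero x
    have hT := h.left_ne_top x
    rw [Pi.mul_apply, Pi.mul_apply, ENNReal.mul_rpow_of_nonneg _ _ (by positivity),
      mul_left_comm, mul_comm (S x), h.right_eq, ← ENNReal.rpow_mul, mul_div_cancel₀ _ hp1.ne',
      ← ENNReal.rpow_neg_one, ← ENNReal.rpow_mul]
    congr 1
    conv_lhs => rw [← ENNReal.rpow_one (W x), ← ENNReal.rpow_mul, one_mul,
      ← ENNReal.rpow_add _ _ h0 hT]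
    congr 1
    field_simp
    ring
  rw [e1] at hGint
  rw [e2] at hGint'
  have e3 : ∀ x, ((Q * G' x) ^ (1 / (p - 1))) ^ p =
      Q ^ (p / (p - 1)) * G' x ^ (p / (p - 1)) := by
    intro x
    rw [← ENNReal.rpow_mul, one_div_mul_eq_div, ENNReal.mul_rpow_of_nonneg _ _ (by positivity)]
  simp_rw [e3]
  rw [lintegral_const_mul _ (by fun_prop)]
  calc _ ≤ Q ^ (p / (p - 1)) * (strongConst (p / (p - 1)) * Λ *
        (strongConst p * Λ' * ∫⁻ x, F x ^ p ∂(μ.withDensity W))) := by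
        gcongr
        exact hGint'.trans (by gcongr)
    _ = _ := by ring

end IsApPair

/-! ### Operator norm bounds and exponents -/

theorem outerLpNorm_maximalOperator_le {ν μ : Measure X} [SFinite ν] {𝓑 : Set (Set X)} {p : ℝ}
    (hp : 0 < p) {f : X → ℝ} {H : X → ℝ≥0∞} (hH : Measurable H)
    (hle : maximalFn μ 𝓑 (fun y => ‖f y‖ₑ) ≤ H) :
    outerLpNorm ν p (maximalOperator μ 𝓑 1 f) ≤ (∫⁻ x, H x ^ p ∂ν) ^ (1 / p) := by
  rw [← lintegral_rpow_eq_layercake hH hp, outerLpNorm]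
  gcongr with t x
  rw [maximalOperator_one, abs_coe_ennreal]
  exact hle x

/-- An `A_p` weight has a version which, together with its dual weight, is an `A_p` pair. -/
theorem IsApWeight.exists_isApPair {μ : Measure X} {𝓑 : Set (Set X)} {hull : Set X → Set X}
    {K p : ℝ} (hb : IsBallBasis μ 𝓑 hull K) (hp : 1 < p) {w : X → ℝ}
    (hw : IsApWeight μ 𝓑 p w) : ∃ W : X → ℝ≥0∞, weightMeasure μ w = μ.withDensity W ∧
      IsApPair μ 𝓑 p (apConst μ 𝓑 p w) W (fun x => W x ^ (-1 / (p - 1))) := by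
  obtain ⟨⟨hm, hpos⟩, hfin⟩ := hw
  let v := hm.mk w
  have hv : Measurable v := hm.measurable_mk
  -- The value 1 on the exceptional null set keeps the density positive everywhere.
  let W : X → ℝ≥0∞ := fun x => ENNReal.ofReal (if 0 < v x then v x else 1)
  have hWm : Measurable W :=
    ENNReal.measurable_ofReal.comp (Measurable.ite (measurableSet_lt measurable_const hv) hv
      measurable_const)
  have hWw : (fun x => ENNReal.ofReal (w x)) =ᵐ[μ] W := by
    filter_upwards [hpos, hm.ae_eq_mk] with x hx hxv
    have hxv : w x = v x := hxv
    simp only [W]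
    rw [← hxv, if_pos hx]
  refine ⟨W, withDensity_congr_ae hWw, hWm, by fun_prop, fun x => ?_, fun x => ?_, fun _ => rfl,
    hp, hfin.ne, hb.measurableSet, fun _ => hb.measure_ne_zero, fun _ => hb.measure_ne_top,
    fun B hB => ?_⟩
  · simp only [W, ne_eq, ENNReal.ofReal_eq_zero, not_le]
    split_ifs with h
    · exact h
    · exact one_pos
  · exact ENNReal.ofReal_ne_top
  · rw [withDensity_apply _ (hb.measurableSet B hB), withDensity_apply _ (hb.measurableSet B hB)]
    refine le_trans (le_of_eq ?_) (le_iSup₂ (f := fun B (_ : B ∈ 𝓑) =>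
      ((μ B)⁻¹ * ∫⁻ x in B, ENNReal.ofReal (w x) ∂μ) *
      ((μ B)⁻¹ * ∫⁻ x in B, ENNReal.ofReal (w x) ^ (-1 / (p - 1)) ∂μ) ^ (p - 1)) B hB)
    have h1 : ∫⁻ x in B, W x ∂μ = ∫⁻ x in B, ENNReal.ofReal (w x) ∂μ :=
      lintegral_congr_ae (ae_restrict_of_ae hWw.symm)
    have h2 : ∫⁻ x in B, W x ^ (-1 / (p - 1)) ∂μ =
        ∫⁻ x in B, ENNReal.ofReal (w x) ^ (-1 / (p - 1)) ∂μ := by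
      refine lintegral_congr_ae (ae_restrict_of_ae ?_)
      filter_upwards [hWw] with x hx
      rw [hx]
    rw [h1, h2]

theorem IsApPair.opNorm_maximalOperator_le {μ : Measure X} [SigmaFinite μ] {𝓑 : Set (Set X)}
    {p : ℝ} {Q : ℝ≥0∞} {W S : X → ℝ≥0∞} (h : IsApPair μ 𝓑 p Q W S) {Λ Λ' : ℝ≥0∞}
    (hW : HasWeakType (μ.withDensity W) 𝓑 Λ) (hS : HasWeakType (μ.withDensity S) 𝓑 Λ') :
    opNorm (μ.withDensity W) p (maximalOperator μ 𝓑 1) ≤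
      (strongConst p * strongConst (p / (p - 1)) * Λ * Λ' * Q ^ (p / (p - 1))) ^ (1 / p) := by
  have hp0 : 0 < p := by linarith [h.one_lt]
  have := SigmaFinite.withDensity_of_ne_top' (μ := μ) h.left_ne_top
  refine iSup₂_le fun f hf => ENNReal.div_le_of_le_mul ?_
  have hfm := hf.aestronglyMeasurable.enorm
  obtain ⟨H, hH, hle, hint⟩ := h.exists_majorant hW hS hfm.measurable_mk
  -- `f` is measurable only up to `W dμ`-null sets; these are `μ`-null since `W` never vanishes, so
  -- its maximal function survives the change of representative.
  have hac : μ ≪ μ.withDensity W := withDensity_absolutelyContinuous'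
    h.measurable_left.aemeasurable (ae_of_all _ h.left_ne_zero)
  rw [← maximalFn_congr (hac.ae_eq hfm.ae_eq_mk)] at hle
  refine (outerLpNorm_maximalOperator_le hp0 hH hle).trans ?_
  rw [eLpNorm_eq_lintegral_rpow_enorm_toReal (by simpa using hp0) ENNReal.ofReal_ne_top,
    ENNReal.toReal_ofReal hp0.le, ← ENNReal.mul_rpow_of_nonneg _ _ (by positivity)]
  refine ENNReal.rpow_le_rpow (hint.trans_eq ?_) (by positivity)
  congr 1
  refine lintegral_congr_ae ?_
  filter_upwards [hfm.ae_eq_mk] with x hx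
  rw [← hx]

/-- An empty space may have no balls, and then `1 ≤ Q` is unavailable; this case is settled
separately. -/
theorem opNorm_eq_zero_of_isEmpty [IsEmpty X] (ν : Measure X) {p : ℝ} (hp : 0 < p)
    (T : (X → ℝ) → X → EReal) : opNorm ν p T = 0 := by
  simp [opNorm, outerLpNorm, Measure.eq_zero_of_isEmpty ν, hp]

theorem rpow_mul_rpow_le {c Q : ℝ≥0∞} {p e E : ℝ} (hp : 0 < p) (hQ : 1 ≤ Q) (hc : c ≠ ∞)
    (hE : e / p ≤ E) : (c * Q ^ e) ^ (1 / p) ≤ (c ^ (1 / p)).toNNReal * Q ^ E := by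
  rw [ENNReal.coe_toNNReal (ENNReal.rpow_ne_top_of_nonneg (by positivity) hc),
    ENNReal.mul_rpow_of_nonneg _ _ (by positivity), ← ENNReal.rpow_mul, mul_one_div]
  gcongr

theorem opNorm_maximalOperator_le_of_ballBasis {p : ℝ} (K : ℝ) (hp : 1 < p) : ∃ C : ℝ≥0,
    ∀ (X : Type u) [MeasurableSpace X] (μ : Measure X) (𝓑 : Set (Set X))
      (hull : Set X → Set X), IsBallBasis μ 𝓑 hull K → ∀ w : X → ℝ, IsApWeight μ 𝓑 p w →
        opNorm (weightMeasure μ w) p (maximalOperator μ 𝓑 1) ≤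
          C * apConst μ 𝓑 p w ^ (2 / (p - 1)) := by
  have hp1 : 0 < p - 1 := by linarith
  have hp0 : 0 < p := by linarith
  have hq : 1 < p / (p - 1) := by rw [lt_div_iff₀ hp1]; linarith
  set k : ℝ≥0∞ := ENNReal.ofReal K ^ p with hk
  have hkT : k ≠ ∞ := ENNReal.rpow_ne_top_of_nonneg hp0.le ENNReal.ofReal_ne_top
  set c : ℝ≥0∞ := strongConst p * strongConst (p / (p - 1)) * k * k ^ (1 / (p - 1)) with hc
  have hcT : c ≠ ∞ := ENNReal.mul_ne_top (ENNReal.mul_ne_top (ENNReal.mul_ne_top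
    (strongConst_ne_top hp) (strongConst_ne_top hq)) hkT)
    (ENNReal.rpow_ne_top_of_nonneg (by positivity) hkT)
  refine ⟨(c ^ (1 / p)).toNNReal, fun X _ μ 𝓑 hull hb w hw => ?_⟩
  rcases isEmpty_or_nonempty X with hX | ⟨⟨x⟩⟩
  · rw [opNorm_eq_zero_of_isEmpty _ hp0]
    exact zero_le
  obtain ⟨B, hB, -, -⟩ := hb.exists_ball x x
  obtain ⟨W, hWeq, h⟩ := hw.exists_isApPair hb hp
  have := hb.sigmaFinite
  have := SigmaFinite.withDensity_of_ne_top' (μ := μ) h.left_ne_top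
  have := SigmaFinite.withDensity_of_ne_top' (μ := μ) h.right_ne_top
  set Q := apConst μ 𝓑 p w
  have hQ : 1 ≤ Q := h.one_le_bound hB
  have hQ0 : Q ≠ 0 := (one_pos.trans_le hQ).ne'
  rw [hWeq]
  refine (h.opNorm_maximalOperator_le
    (hb.hasWeakType (fun _ => h.left_measure_ne_zero) (fun _ => h.left_measure_ne_top)
      fun _ => h.left_measure_hull_le hb)
    (hb.hasWeakType (fun _ => h.right_measure_ne_zero) (fun _ => h.right_measure_ne_top)
      fun _ => h.right_measure_hull_le hb)).trans ?_
  -- The three powers of `Q` come from doubling of `W`, doubling of `S` and the pointwise bound;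
  -- their sum divided by `p` is `2 / (p - 1)`.
  refine le_trans (le_of_eq ?_) (rpow_mul_rpow_le (e := 1 + 1 / (p - 1) + p / (p - 1)) hp0 hQ hcT
    (le_of_eq (by field_simp; ring)))
  congr 1
  rw [ENNReal.rpow_add _ _ hQ0 h.bound_ne_top, ENNReal.rpow_add _ _ hQ0 h.bound_ne_top,
    ENNReal.rpow_one, ENNReal.mul_rpow_of_nonneg _ _ (by positivity)]
  ring

theorem opNorm_maximalOperator_le_of_besicovitch {p : ℝ} (K : ℝ) (D : ℕ) (hp : 1 < p) :
    ∃ C : ℝ≥0, ∀ (X : Type u) [MeasurableSpace X] (μ : Measure X) (𝓑 : Set (Set X))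
      (hull : Set X → Set X), IsBallBasis μ 𝓑 hull K → IsBesicovitch 𝓑 D →
        ∀ w : X → ℝ, IsApWeight μ 𝓑 p w →
          opNorm (weightMeasure μ w) p (maximalOperator μ 𝓑 1) ≤
            C * apConst μ 𝓑 p w ^ (1 / (p - 1)) := by
  have hp1 : 0 < p - 1 := by linarith
  have hp0 : 0 < p := by linarith
  have hq : 1 < p / (p - 1) := by rw [lt_div_iff₀ hp1]; linarith
  set c : ℝ≥0∞ := strongConst p * strongConst (p / (p - 1)) * D * D with hc
  have hcT : c ≠ ∞ := ENNReal.mul_ne_top (ENNReal.mul_ne_top (ENNReal.mul_ne_top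
    (strongConst_ne_top hp) (strongConst_ne_top hq)) (by simp)) (by simp)
  refine ⟨(c ^ (1 / p)).toNNReal, fun X _ μ 𝓑 hull hb hD w hw => ?_⟩
  rcases isEmpty_or_nonempty X with hX | ⟨⟨x⟩⟩
  · rw [opNorm_eq_zero_of_isEmpty _ hp0]
    exact zero_le
  obtain ⟨B, hB, -, -⟩ := hb.exists_ball x x
  obtain ⟨W, hWeq, h⟩ := hw.exists_isApPair hb hp
  have := hb.sigmaFinite
  have := SigmaFinite.withDensity_of_ne_top' (μ := μ) h.left_ne_top
  have := SigmaFinite.withDensity_of_ne_top' (μ := μ) h.right_ne_top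
  rw [hWeq]
  refine (h.opNorm_maximalOperator_le
    (hD.hasWeakType hb.measurableSet (fun _ => h.left_measure_ne_zero)
      fun _ => h.left_measure_ne_top)
    (hD.hasWeakType hb.measurableSet (fun _ => h.right_measure_ne_zero)
      fun _ => h.right_measure_ne_top)).trans ?_
  exact rpow_mul_rpow_le hp0 (h.one_le_bound hB) hcT (le_of_eq (by field_simp))

/-- The characteristic of an `A_p` weight on a nonempty ball-basis is at least one, so that bounds
by its powers are monotone in the exponent. -/
theorem opNorm_le_of_exponent_le {μ : Measure X} {𝓑 : Set (Set X)} {hull : Set X → Set X}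
    {K p e E : ℝ} (hb : IsBallBasis μ 𝓑 hull K) (hp : 1 < p) {w : X → ℝ}
    (hw : IsApWeight μ 𝓑 p w) {C : ℝ≥0} {T : (X → ℝ) → X → EReal} {ν : Measure X} (he : e ≤ E)
    (h : opNorm ν p T ≤ C * apConst μ 𝓑 p w ^ e) : opNorm ν p T ≤ C * apConst μ 𝓑 p w ^ E := by
  rcases isEmpty_or_nonempty X with hX | ⟨⟨x⟩⟩
  · rw [opNorm_eq_zero_of_isEmpty _ (by linarith)]
    exact zero_le
  obtain ⟨B, hB, -, -⟩ := hb.exists_ball x x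
  obtain ⟨W, -, hW⟩ := hw.exists_isApPair hb hp
  refine h.trans ?_
  gcongr
  exact hW.one_le_bound hB

/-- The first entry suffices for `p ≤ 2`; the second for `p ≥ 2`, where the inequality reads `(3p -
1)(p - 2) ≥ 0`. All three agree at `p = 2`. -/
theorem two_div_le_max {p : ℝ} (hp : 1 < p) :
    2 / (p - 1) ≤ max ((p + 2) / (p * (p - 1))) ((3 * p - 2) / p) := by
  have hp1 : 0 < p - 1 := by linarith
  have hp0 : 0 < p := by linarith
  rcases le_total p 2 with h | h
  · refine le_max_of_le_left ?_
    rw [div_le_div_iff₀ hp1 (by positivity)]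
    nlinarith
  · refine le_max_of_le_right ?_
    rw [div_le_div_iff₀ hp1 hp0]
    nlinarith

end BallBasis

theorem mainTheorem12 :
    -- the maximal operator is a bounded oscillation operator
    (∀ (X : Type u) [MeasurableSpace X] (μ : Measure X) (𝓑 : Set (Set X))
      (hull : Set X → Set X) (K : ℝ), BallBasis.IsBallBasis μ 𝓑 hull K →
        BallBasis.IsBO μ 𝓑 hull 1 (BallBasis.maximalOperator μ 𝓑 1)) ∧
    -- the weighted bound for a general ball-basis
    (∀ p K : ℝ, 1 < p → ∃ C : ℝ≥0,
      ∀ (X : Type u) [MeasurableSpace X] (μ : Measure X) (𝓑 : Set (Set X))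
        (hull : Set X → Set X), BallBasis.IsBallBasis μ 𝓑 hull K →
        ∀ w : X → ℝ, BallBasis.IsApWeight μ 𝓑 p w →
          BallBasis.opNorm (BallBasis.weightMeasure μ w) p (BallBasis.maximalOperator μ 𝓑 1) ≤
            C * BallBasis.apConst μ 𝓑 p w ^
              max ((p + 2) / (p * (p - 1))) ((3 * p - 2) / p)) ∧
    -- the weighted bound under the Besicovitch condition
    (∀ (p K : ℝ) (D : ℕ), 1 < p → ∃ C : ℝ≥0,
      ∀ (X : Type u) [MeasurableSpace X] (μ : Measure X) (𝓑 : Set (Set X))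
        (hull : Set X → Set X), BallBasis.IsBallBasis μ 𝓑 hull K →
        BallBasis.IsBesicovitch 𝓑 D →
        ∀ w : X → ℝ, BallBasis.IsApWeight μ 𝓑 p w →
          BallBasis.opNorm (BallBasis.weightMeasure μ w) p (BallBasis.maximalOperator μ 𝓑 1) ≤
            C * BallBasis.apConst μ 𝓑 p w ^ max 1 (1 / (p - 1))) := by
  refine ⟨fun X _ μ 𝓑 hull K h => BallBasis.isBO_maximalOperator h, fun p K hp => ?_,
    fun p K D hp => ?_⟩
  · obtain ⟨C, hC⟩ := BallBasis.opNorm_maximalOperator_le_of_ballBasis.{u} K hp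
    exact ⟨C, fun X _ μ 𝓑 hull hb w hw => BallBasis.opNorm_le_of_exponent_le hb hp hw
      (BallBasis.two_div_le_max hp) (hC X μ 𝓑 hull hb w hw)⟩
  · obtain ⟨C, hC⟩ := BallBasis.opNorm_maximalOperator_le_of_besicovitch.{u} K D hp
    exact ⟨C, fun X _ μ 𝓑 hull hb hD w hw => BallBasis.opNorm_le_of_exponent_le hb hp hw
      (le_max_right _ _) (hC X μ 𝓑 hull hb hD w hw)⟩
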